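/- Let $1<p<2$ and define $p^*\in(2,\infty)$ by $\frac1p=\frac12+\frac1{p^*}$. There is a number $\alpha=\alpha(p)$ with $0<\alpha<1/p$, and for every $\chi\in C_0^\infty(\mathbb{C})$ there is a constant $C=C(p,\chi)>0$, such that the following holds. Let $\Omega,X\subset\mathbb{R}^2\equiv\mathbb{C}$ be bounded domains with $\overline\Omega\subset X$, and suppose that $\operatorname{supp}\chi\subset X$ and $\chi\equiv 1$ on $\Omega$. Let $\tau>1$, $z_0\in\mathbb{C}$ and $\Phi(z)=(z-z_0)^2$. Let $q_1,q_2\in L^p(\Omega)$, extended by zero outside $\Omega$. Write $$\overline\partial^{-1}u=\frac1{\pi z}*u,\qquad \partial^{-1}u=\frac1{\pi\overline z}*u$$ for the Cauchy operators, and put $$S_1f=-\tfrac14\,\overline\partial^{-1}\Big(e^{-i\tau(\Phi+\overline\Phi)}\chi\,\partial^{-1}\big(e^{i\tau(\Phi+\overline\Phi)}q_1f\big)\Big),\qquad S_2f=-\tfrac14\,\partial^{-1}\Big(e^{-i\tau(\Phi+\overline\Phi)}\chi\,\overline\partial^{-1}\big(e^{i\tau(\Phi+\overline\Phi)}q_2f\big)\Big).$$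 Then for $j=1,2$ the formula for $S_j$ (whose convolution integrals converge absolutely almost everywhere) defines linear maps $L^\infty(X)\to L^{p^*}(X)$ and $L^\infty(X)\to L^\infty(X)$ with $$\|S_jf\|_{L^{p^*}(X)}\le C\,\|q_j\|_{L^p(\Omega)}\,\tau^{-1/2}\,\|f\|_{L^\infty(X)},\qquad \|S_jf\|_{L^\infty(X)}\le C\,\|q_j\|_{L^p(\Omega)}\,\tau^{-\alpha}\,\|f\|_{L^\infty(X)}.$$ If in addition $p>4/3$, then the same formula defines a linear map $L^{p^*}(X)\to L^{p^*/2}(X)$, extending $S_j$ from $L^\infty(X)$, with $$\|S_jf\|_{L^{p^*/2}(X)}\le C\,\|q_j\|_{L^p(\Omega)}\,\tau^{-1/2}\,\|f\|_{L^{p^*}(X)}.$$ -/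

import Mathlib

open MeasureTheory Set
open scoped ENNReal ContDiff ComplexConjugate

noncomputable section

/-- The Cauchy operator `∂̄⁻¹ u = (1 / (π z)) * u` (convolution on the plane `ℝ² = ℂ`). -/
def dbarInv (u : ℂ → ℂ) (z : ℂ) : ℂ :=
  ∫ w : ℂ, 1 / ((Real.pi : ℂ) * (z - w)) * u w

/-- The Cauchy operator `∂⁻¹ u = (1 / (π z̄)) * u` (convolution on the plane `ℝ² = ℂ`). -/
def dInv (u : ℂ → ℂ) (z : ℂ) : ℂ :=
  ∫ w : ℂ, 1 / ((Real.pi : ℂ) * conj (z - w)) * u w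

/-- The convolution integrals defining `∂̄⁻¹ u` and `∂⁻¹ u` converge absolutely at almost every
point of the plane (the two kernels have the same modulus). -/
def CauchyConverges (u : ℂ → ℂ) : Prop :=
  ∀ᵐ z : ℂ, Integrable (fun w : ℂ => 1 / ((Real.pi : ℂ) * (z - w)) * u w) ∧
    Integrable (fun w : ℂ => 1 / ((Real.pi : ℂ) * conj (z - w)) * u w)

/-- The phase `Φ(z) = (z - z₀)²`. -/
def phase (z₀ z : ℂ) : ℂ := (z - z₀) ^ 2

/-- The unimodular function `exp (i τ (Φ + Φ̄))`. -/
def osc (τ : ℝ) (z₀ z : ℂ) : ℂ :=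
  Complex.exp (Complex.I * (τ : ℂ) * (phase z₀ z + conj (phase z₀ z)))

/-- The function `exp (i τ (Φ + Φ̄)) q f`, where the potential `q` on `Ω` is extended by zero
outside `Ω`. -/
def oscPotential (Ω : Set ℂ) (q : ℂ → ℂ) (τ : ℝ) (z₀ : ℂ) (f : ℂ → ℂ) (z : ℂ) : ℂ :=
  osc τ z₀ z * (Ω.indicator q z * f z)

/-- The function `exp (-i τ (Φ + Φ̄)) χ g`. -/
def oscCutoff (χ : ℂ → ℂ) (τ : ℝ) (z₀ : ℂ) (g : ℂ → ℂ) (z : ℂ) : ℂ :=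
  osc (-τ) z₀ z * (χ z * g z)

/-- `S₁ f = -(1/4) ∂̄⁻¹ (exp (-i τ (Φ + Φ̄)) χ ∂⁻¹ (exp (i τ (Φ + Φ̄)) q f))`. -/
def opS₁ (Ω : Set ℂ) (χ q : ℂ → ℂ) (τ : ℝ) (z₀ : ℂ) (f : ℂ → ℂ) (z : ℂ) : ℂ :=
  -(1 / 4) * dbarInv (oscCutoff χ τ z₀ (dInv (oscPotential Ω q τ z₀ f))) z

/-- `S₂ f = -(1/4) ∂⁻¹ (exp (-i τ (Φ + Φ̄)) χ ∂̄⁻¹ (exp (i τ (Φ + Φ̄)) q f))`. -/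
def opS₂ (Ω : Set ℂ) (χ q : ℂ → ℂ) (τ : ℝ) (z₀ : ℂ) (f : ℂ → ℂ) (z : ℂ) : ℂ :=
  -(1 / 4) * dInv (oscCutoff χ τ z₀ (dbarInv (oscPotential Ω q τ z₀ f))) z

/-- Both convolution integrals in the formula for `S₁ f` converge absolutely almost everywhere. -/
def S₁Converges (Ω : Set ℂ) (χ q : ℂ → ℂ) (τ : ℝ) (z₀ : ℂ) (f : ℂ → ℂ) : Prop :=
  CauchyConverges (oscPotential Ω q τ z₀ f) ∧
    CauchyConverges (oscCutoff χ τ z₀ (dInv (oscPotential Ω q τ z₀ f)))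

/-- Both convolution integrals in the formula for `S₂ f` converge absolutely almost everywhere. -/
def S₂Converges (Ω : Set ℂ) (χ q : ℂ → ℂ) (τ : ℝ) (z₀ : ℂ) (f : ℂ → ℂ) : Prop :=
  CauchyConverges (oscPotential Ω q τ z₀ f) ∧
    CauchyConverges (oscCutoff χ τ z₀ (dbarInv (oscPotential Ω q τ z₀ f)))

/-- A formula `A` for functions, meaningful at `f` when `conv f` holds, defines a linear map
`L^r(X) → L^s(X)` (between spaces of classes of functions) with operator norm at most `K`. -/
def MapsBoundedly (X : Set ℂ) (r s : ℝ≥0∞) (conv : (ℂ → ℂ) → Prop)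
    (A : (ℂ → ℂ) → ℂ → ℂ) (K : ℝ) : Prop :=
  ∃ T : Lp ℂ r (volume.restrict X) →ₗ[ℂ] Lp ℂ s (volume.restrict X),
    (∀ f : Lp ℂ r (volume.restrict X), conv (f : ℂ → ℂ) ∧
        (T f : ℂ → ℂ) =ᵐ[volume.restrict X] A (f : ℂ → ℂ)) ∧
      ∀ f : Lp ℂ r (volume.restrict X), ‖T f‖ ≤ K * ‖f‖

/-- `Ω` and `X` are bounded domains of the plane, the closure of `Ω` is contained in `X`, and the
smooth function `χ` is compactly supported in `X` and equal to `1` on `Ω`. -/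
structure UsualAssumptions (Ω X : Set ℂ) (χ : ℂ → ℂ) : Prop where
  isOpen_Ω : IsOpen Ω
  isConnected_Ω : IsConnected Ω
  isBounded_Ω : Bornology.IsBounded Ω
  isOpen_X : IsOpen X
  isConnected_X : IsConnected X
  isBounded_X : Bornology.IsBounded X
  closure_subset : closure Ω ⊆ X
  smooth : ContDiff ℝ ∞ χ
  compactSupport : HasCompactSupport χ
  support_subset : tsupport χ ⊆ X
  eq_one : ∀ z ∈ Ω, χ z = 1

/-- The norm of `q` in `L^p(Ω)`. -/
def potentialNorm (p : ℝ) (Ω : Set ℂ) (q : ℂ → ℂ) : ℝ :=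
  (eLpNorm q (ENNReal.ofReal p) (volume.restrict Ω)).toReal

end

/-!
Both operators are of the form `f ↦ -(1/4) l₁⁻¹ (φ l₂⁻¹ g)`, where `l₁`, `l₂` are the identity or
complex conjugation, `l⁻¹` denotes convolution with `1 / (π l(z))`, `φ = exp (-iτ(Φ + Φ̄)) χ`, and
`g = exp (iτ(Φ + Φ̄)) q f` is supported in the support of `χ`. By Fubini's theorem
(`enorm_twoCauchy_le`) such an operator has the kernel
`K(z, w) = ∫ φ(ζ) / (l₁ (z - ζ) l₂ (ζ - w)) dζ` up to a constant, and everything follows from two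
bounds for `K`.

The main bound is `|K(z, w)| ≤ C τ^(-1/2) / |z - w|` (`enorm_crossKernel_osc_le`), uniformly in the
critical point `z₀` and without any loss on the diagonal. With `s = τ^(-1/2)`, replace each kernel
`1 / l(x)` by the smooth function `conj (l x) / (|x|² + s²)`, and divide by the derivative
`∂̄(Φ + Φ̄) = 2 conj (ζ - z₀)` of the phase in the regularised form
`(ζ - z₀) / (|ζ - z₀|² + s²)`; one integration by parts is then legitimate. All errors are products
of (regularised) inverse distances from `ζ` to `z`, `w` and `z₀`, of total degree four and with a
factor `s²`. One degree is traded for `1 / |z - w|` by the triangle inequality,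
`1/(ab) ≤ (1/a + 1/b) / |z - w|` if `|z - w| ≤ a + b`. A product of decreasing functions of three
distances is dominated by the sum over the three points of the product at one of them, so what is
left is the integral of `1 / (|x| (|x|² + s²))`, which is of order `1 / s`.

The bounds `L^∞ → L^{p*}` and `L^{p*} → L^{p*/2}` with the gain `τ^(-1/2)` follow from the main bound
together with Hölder's inequality for `q f` and the Hardy–Littlewood–Sobolev inequality
(`hardyLittlewoodSobolev`), which is proved here by splitting both the function and the
kernel at heights depending on the level. For `L^∞ → L^∞`, the main bound is interpolated with the
trivial bound `|K(z, w)| ≤ C |z - w|^(-ε)`; for `ε = (1 - 1/p) / 2` the resulting kernel has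
an `L^{p'}` norm uniformly bounded in `z`, and the gain is `τ^(-α)` with `α = (1 - 1/p) / 4`.
-/

open scoped NNReal

/-! ### Radial integrals in the plane -/

theorem lintegral_radial {F : ℝ → ℝ≥0∞} (hF : Measurable F) :
    ∫⁻ z : ℂ, F ‖z‖ = ENNReal.ofReal (2 * Real.pi) *
      ∫⁻ r in Ioi (0 : ℝ), ENNReal.ofReal r * F r := by
  rw [← Complex.lintegral_comp_polarCoord_symm]
  have h1 : ∀ p ∈ polarCoord.target, ENNReal.ofReal p.1 • F ‖Complex.polarCoord.symm p‖
      = ENNReal.ofReal p.1 * F p.1 * 1 := by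
    intro p hp
    rw [polarCoord_target] at hp
    rw [Complex.norm_polarCoord_symm, abs_of_pos hp.1, smul_eq_mul, mul_one]
  rw [setLIntegral_congr_fun polarCoord.open_target.measurableSet h1,
    polarCoord_target, Measure.volume_eq_prod, ← Measure.prod_restrict,
    lintegral_prod_mul (f := fun r => ENNReal.ofReal r * F r) (g := fun _ => 1)]
  · rw [lintegral_one, Measure.restrict_apply_univ, Real.volume_Ioo, mul_comm]
    congr 2
    ring
  · fun_prop
  · fun_prop

theorem setLIntegral_ofReal_rpow_Ioc {a R : ℝ} (ha : -1 < a) (hR : 0 ≤ R) :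
    ∫⁻ r in Ioc 0 R, ENNReal.ofReal (r ^ a) = ENNReal.ofReal (R ^ (a + 1) / (a + 1)) := by
  have hi : IntegrableOn (fun r : ℝ => r ^ a) (Ioc 0 R) :=
    (intervalIntegrable_iff_integrableOn_Ioc_of_le hR).1
      (intervalIntegral.intervalIntegrable_rpow' ha)
  rw [← ofReal_integral_eq_lintegral_ofReal hi, ← intervalIntegral.integral_of_le hR,
    integral_rpow (Or.inl ha), Real.zero_rpow (by linarith), sub_zero]
  filter_upwards [ae_restrict_mem measurableSet_Ioc] with r hr
  exact Real.rpow_nonneg hr.1.le _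

theorem setLIntegral_ofReal_rpow_Ioi {a R : ℝ} (ha : a < -1) (hR : 0 < R) :
    ∫⁻ r in Ioi R, ENNReal.ofReal (r ^ a) = ENNReal.ofReal (-R ^ (a + 1) / (a + 1)) := by
  rw [← ofReal_integral_eq_lintegral_ofReal (integrableOn_Ioi_rpow_of_lt ha hR),
    integral_Ioi_rpow_of_lt ha hR]
  filter_upwards [ae_restrict_mem measurableSet_Ioi] with r hr
  exact Real.rpow_nonneg (hR.le.trans (le_of_lt hr)) _

theorem lintegral_norm_rpow_near {a R : ℝ} (ha : -2 < a) (hR : 0 ≤ R) :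
    ∫⁻ z : ℂ, (if ‖z‖ ≤ R then ENNReal.ofReal (‖z‖ ^ a) else 0) =
      ENNReal.ofReal (2 * Real.pi * (R ^ (a + 2) / (a + 2))) := by
  rw [lintegral_radial (F := fun r => if r ≤ R then ENNReal.ofReal (r ^ a) else 0)
    (Measurable.ite measurableSet_Iic (by fun_prop) (by fun_prop)),
    ENNReal.ofReal_mul (p := 2 * Real.pi) (by positivity)]
  congr 1
  rw [show a + 2 = (a + 1) + 1 by ring, ← setLIntegral_ofReal_rpow_Ioc (by linarith) hR,
    ← lintegral_indicator measurableSet_Ioi, ← lintegral_indicator measurableSet_Ioc]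
  congr 1 with r
  by_cases h0 : 0 < r <;> by_cases h1 : r ≤ R <;> simp [indicator, h0, h1]
  rw [← ENNReal.ofReal_mul h0.le, Real.rpow_add h0, Real.rpow_one, mul_comm]

theorem lintegral_norm_rpow_far {a R : ℝ} (ha : a < -2) (hR : 0 < R) :
    ∫⁻ z : ℂ, (if R < ‖z‖ then ENNReal.ofReal (‖z‖ ^ a) else 0) =
      ENNReal.ofReal (2 * Real.pi * (-R ^ (a + 2) / (a + 2))) := by
  rw [lintegral_radial (F := fun r => if R < r then ENNReal.ofReal (r ^ a) else 0)
    (Measurable.ite measurableSet_Ioi (by fun_prop) (by fun_prop)),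
    ENNReal.ofReal_mul (p := 2 * Real.pi) (by positivity)]
  congr 1
  rw [show a + 2 = (a + 1) + 1 by ring, ← setLIntegral_ofReal_rpow_Ioi (by linarith) hR,
    ← lintegral_indicator measurableSet_Ioi, ← lintegral_indicator measurableSet_Ioi]
  congr 1 with r
  by_cases h1 : R < r
  · have h0 : 0 < r := hR.trans h1
    simp [indicator, h0, h1]
    rw [← ENNReal.ofReal_mul h0.le, Real.rpow_add h0, Real.rpow_one, mul_comm]
  · simp [indicator, h1]

theorem lintegral_inv_norm_near {R : ℝ} (hR : 0 ≤ R) :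
    ∫⁻ z : ℂ, (if ‖z‖ ≤ R then ENNReal.ofReal ‖z‖⁻¹ else 0) =
      ENNReal.ofReal (2 * Real.pi * R) := by
  have := lintegral_norm_rpow_near (a := -1) (by norm_num) hR
  simp only [Real.rpow_neg_one] at this
  rw [this]
  norm_num

/-- The regularised cubic singularity `1 / (|x| (|x|² + s²))`, integrable over the plane with
integral of order `1 / s`. -/
noncomputable def cubicBump (s : ℝ) (x : ℂ) : ℝ := (‖x‖ * (‖x‖ ^ 2 + s ^ 2))⁻¹

theorem cubicBump_nonneg (s : ℝ) (x : ℂ) : 0 ≤ cubicBump s x := by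
  unfold cubicBump; positivity

@[fun_prop]
theorem measurable_cubicBump (s : ℝ) : Measurable (cubicBump s) := by
  unfold cubicBump; fun_prop

theorem lintegral_cubicBump_le {s : ℝ} (hs : 0 < s) :
    ∫⁻ x : ℂ, ENNReal.ofReal (cubicBump s x) ≤ ENNReal.ofReal (4 * Real.pi * s⁻¹) := by
  have hpt : ∀ x : ℂ, ENNReal.ofReal (cubicBump s x) ≤
      ENNReal.ofReal ((s ^ 2)⁻¹) * (if ‖x‖ ≤ s then ENNReal.ofReal ‖x‖⁻¹ else 0) +
      (if s < ‖x‖ then ENNReal.ofReal (‖x‖ ^ (-3 : ℝ)) else 0) := by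
    intro x
    rcases le_or_gt ‖x‖ s with h | h
    · rw [if_pos h, if_neg (not_lt.2 h), add_zero, ← ENNReal.ofReal_mul (by positivity)]
      apply ENNReal.ofReal_le_ofReal
      unfold cubicBump
      rw [mul_inv, mul_comm]
      gcongr
      nlinarith [norm_nonneg x]
    · rw [if_neg (not_le.2 h), if_pos h, mul_zero, zero_add]
      apply ENNReal.ofReal_le_ofReal
      have hx : 0 < ‖x‖ := hs.trans h
      unfold cubicBump
      rw [Real.rpow_neg hx.le]
      gcongr
      rw [show (3 : ℝ) = ((3 : ℕ) : ℝ) by norm_num, Real.rpow_natCast]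
      nlinarith [sq_nonneg s]
  refine (lintegral_mono hpt).trans ?_
  rw [lintegral_add_right, lintegral_const_mul, lintegral_inv_norm_near hs.le,
    lintegral_norm_rpow_far (by norm_num) hs, ← ENNReal.ofReal_mul (by positivity),
    ← ENNReal.ofReal_add (by positivity)]
  · apply ENNReal.ofReal_le_ofReal
    norm_num [Real.rpow_neg_one]
    apply le_of_eq
    field_simp
    ring
  · norm_num
    positivity
  · exact Measurable.ite (measurableSet_le (by fun_prop) (by fun_prop)) (by fun_prop) (by fun_prop)
  · exact Measurable.ite (measurableSet_lt (by fun_prop) (by fun_prop)) (by fun_prop) (by fun_prop)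

theorem setLIntegral_norm_sub_rpow_le {a : ℝ} (ha : -2 < a) (ha' : a ≤ 0) (S : Set ℂ) (z : ℂ) :
    ∫⁻ w in S, ENNReal.ofReal (‖w - z‖ ^ a) ≤
      volume S + ENNReal.ofReal (2 * Real.pi * (1 / (a + 2))) := by
  have hpt : ∀ w : ℂ, ENNReal.ofReal (‖w - z‖ ^ a) ≤
      1 + (if ‖w - z‖ ≤ 1 then ENNReal.ofReal (‖w - z‖ ^ a) else 0) := by
    intro w
    rcases le_or_gt ‖w - z‖ 1 with h | h
    · simp [h]
    · rw [if_neg (not_le.2 h), add_zero, ← ENNReal.ofReal_one]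
      exact ENNReal.ofReal_le_ofReal (Real.rpow_le_one_of_one_le_of_nonpos h.le ha')
  refine (lintegral_mono hpt).trans ?_
  rw [lintegral_add_left measurable_const, setLIntegral_one]
  gcongr
  refine (setLIntegral_le_lintegral _ _).trans ?_
  rw [lintegral_sub_right_eq_self
    (fun w : ℂ => if ‖w‖ ≤ 1 then ENNReal.ofReal (‖w‖ ^ a) else 0) z,
    lintegral_norm_rpow_near ha zero_le_one]
  simp

/-- The layer-cake formula for a single value. -/
theorem lintegral_rpow_of_lt {m : ℝ} (hm : 0 < m) (y : ℝ≥0∞) :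
    ∫⁻ t in Ioi (0 : ℝ), (if ENNReal.ofReal t < y then ENNReal.ofReal (t ^ (m - 1)) else 0) =
      ENNReal.ofReal m⁻¹ * y ^ m := by
  have key : ∀ Y : ℝ, 0 ≤ Y → ∫⁻ t in Ioi (0 : ℝ),
      (if t < Y then ENNReal.ofReal (t ^ (m - 1)) else 0) =
      ENNReal.ofReal m⁻¹ * ENNReal.ofReal Y ^ m := by
    intro Y hY
    rw [ENNReal.ofReal_rpow_of_nonneg hY hm.le, ← ENNReal.ofReal_mul (by positivity),
      inv_mul_eq_div]
    have := setLIntegral_ofReal_rpow_Ioc (a := m - 1) (by linarith) hY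
    rw [sub_add_cancel] at this
    rw [← this, setLIntegral_congr Ioo_ae_eq_Ioc.symm, ← lintegral_indicator measurableSet_Ioi,
      ← lintegral_indicator measurableSet_Ioo]
    congr 1 with r
    by_cases h0 : 0 < r <;> by_cases h1 : r < Y <;> simp [indicator, h0, h1]
  induction y with
  | coe y =>
    have := key y y.2
    rw [ENNReal.ofReal_coe_nnreal] at this
    rw [← this]
    refine setLIntegral_congr_fun measurableSet_Ioi fun t ht => ?_
    have : ENNReal.ofReal t < y ↔ t < y := by
      rw [ENNReal.ofReal_lt_coe_iff (le_of_lt ht)]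
    simp only [this]
  | top =>
    rw [ENNReal.top_rpow_of_pos hm, ENNReal.mul_top (by positivity)]
    refine ENNReal.eq_top_of_forall_nnreal_le fun r => ?_
    set Y : ℝ := (m * r) ^ m⁻¹ with hYdef
    have hY : 0 ≤ Y := by positivity
    have h1 := key Y hY
    have h2 : ENNReal.ofReal m⁻¹ * ENNReal.ofReal Y ^ m = r := by
      rw [ENNReal.ofReal_rpow_of_nonneg hY hm.le, ← ENNReal.ofReal_mul (by positivity), hYdef,
        Real.rpow_inv_rpow (by positivity) hm.ne', inv_mul_cancel_left₀ hm.ne',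
        ENNReal.ofReal_coe_nnreal]
    rw [← h2, ← h1]
    refine lintegral_mono fun t => ?_
    simp only [ENNReal.ofReal_lt_top, if_true]
    split_ifs <;> simp

/-! ### The Hardy–Littlewood–Sobolev inequality -/

/-- The Riesz potential of order one on the plane, `∫ g(w) / |z - w| dw`, for functions with
values in `[0, ∞]`. The junk value `0⁻¹ = 0` at `w = z` concerns a null set only. -/
noncomputable def rieszPotential (g : ℂ → ℝ≥0∞) (z : ℂ) : ℝ≥0∞ :=
  ∫⁻ w : ℂ, ENNReal.ofReal ‖z - w‖⁻¹ * g w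

@[fun_prop]
theorem measurable_rieszPotential {g : ℂ → ℝ≥0∞} (hg : Measurable g) :
    Measurable (rieszPotential g) := by
  unfold rieszPotential
  exact Measurable.lintegral_prod_right' (f := fun x : ℂ × ℂ => ENNReal.ofReal ‖x.1 - x.2‖⁻¹ * g x.2)
    (by fun_prop)

theorem rieszPotential_congr {g g' : ℂ → ℝ≥0∞} (h : g =ᵐ[volume] g') :
    rieszPotential g = rieszPotential g' := by
  funext z
  refine lintegral_congr_ae ?_
  filter_upwards [h] with w hw
  rw [hw]

theorem lintegral_near_sub {R : ℝ} (hR : 0 ≤ R) (z : ℂ) :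
    ∫⁻ w : ℂ, (if ‖z - w‖ ≤ R then ENNReal.ofReal ‖z - w‖⁻¹ else 0) =
      ENNReal.ofReal (2 * Real.pi * R) := by
  rw [lintegral_sub_left_eq_self
    (fun w : ℂ => if ‖w‖ ≤ R then ENNReal.ofReal ‖w‖⁻¹ else 0) z, lintegral_inv_norm_near hR]

theorem measurable_near (R : ℝ) : Measurable (fun x : ℂ × ℂ =>
    if ‖x.1 - x.2‖ ≤ R then ENNReal.ofReal ‖x.1 - x.2‖⁻¹ else 0) :=
  Measurable.ite (measurableSet_le (by fun_prop) (by fun_prop)) (by fun_prop) (by fun_prop)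

theorem measurable_near_left (R : ℝ) (z : ℂ) : Measurable (fun w : ℂ =>
    if ‖z - w‖ ≤ R then ENNReal.ofReal ‖z - w‖⁻¹ else 0) :=
  Measurable.ite (measurableSet_le (by fun_prop) (by fun_prop)) (by fun_prop) (by fun_prop)

theorem measurable_far_left (R : ℝ) (z : ℂ) : Measurable (fun w : ℂ =>
    if R < ‖z - w‖ then ENNReal.ofReal ‖z - w‖⁻¹ else 0) :=
  Measurable.ite (measurableSet_lt (by fun_prop) (by fun_prop)) (by fun_prop) (by fun_prop)

/-- Hölder's inequality for the part of the potential away from a disc. -/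
theorem lintegral_far_mul_le {p m R : ℝ} (hpm : m.HolderConjugate p) (hm : 2 < m) (hR : 0 < R)
    {g : ℂ → ℝ≥0∞} (hg : Measurable g) (hg1 : ∫⁻ w, g w ^ p ≤ 1) (z : ℂ) :
    ∫⁻ w : ℂ, (if R < ‖z - w‖ then ENNReal.ofReal ‖z - w‖⁻¹ else 0) * g w ≤
      ENNReal.ofReal ((2 * Real.pi / (m - 2)) ^ (1 / m) * R ^ ((2 - m) / m)) := by
  have hm0 : 0 < m := by linarith
  refine (ENNReal.lintegral_mul_le_Lp_mul_Lq volume hpm (measurable_far_left R z).aemeasurable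
    hg.aemeasurable).trans ?_
  have h1 : (∫⁻ w, g w ^ p) ^ (1 / p) ≤ 1 := by
    calc _ ≤ (1 : ℝ≥0∞) ^ (1 / p) := by
          gcongr
          have := hpm.symm.pos
          positivity
      _ = 1 := ENNReal.one_rpow _
  have h2 : ∫⁻ w : ℂ, (if R < ‖z - w‖ then ENNReal.ofReal ‖z - w‖⁻¹ else 0) ^ m =
      ENNReal.ofReal (2 * Real.pi / (m - 2) * R ^ (2 - m)) := by
    have e : ∀ w : ℂ, (if R < ‖z - w‖ then ENNReal.ofReal ‖z - w‖⁻¹ else 0) ^ m =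
        (if R < ‖z - w‖ then ENNReal.ofReal (‖z - w‖ ^ (-m)) else 0) := by
      intro w
      split_ifs with h
      · rw [ENNReal.ofReal_rpow_of_nonneg (by positivity) hm0.le, Real.inv_rpow (norm_nonneg _),
          Real.rpow_neg (norm_nonneg _)]
      · exact ENNReal.zero_rpow_of_pos hm0
    simp_rw [e]
    rw [lintegral_sub_left_eq_self
      (fun w : ℂ => if R < ‖w‖ then ENNReal.ofReal (‖w‖ ^ (-m)) else 0) z,
      lintegral_norm_rpow_far (by linarith) hR]
    congr 1
    rw [show -m + 2 = 2 - m by ring, show (m - 2) = -(2 - m) by ring]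
    have : 2 - m ≠ 0 := by linarith
    field_simp
  rw [h2]
  calc _ ≤ ENNReal.ofReal (2 * Real.pi / (m - 2) * R ^ (2 - m)) ^ (1 / m) * 1 := by gcongr
    _ = _ := by
      have : 0 < m - 2 := by linarith
      rw [mul_one, ENNReal.ofReal_rpow_of_nonneg (by positivity) (by positivity),
        Real.mul_rpow (by positivity) (by positivity), ← Real.rpow_mul hR.le]
      congr 3
      ring

/-- The level sets of the potential: only the large values of `g` near the point contribute. -/
theorem volume_lt_rieszPotential_le {g : ℂ → ℝ≥0∞} (hg : Measurable g) {t R : ℝ} (ht : 0 < t)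
    (hR : 0 < R) (hfar : ∀ z : ℂ, ∫⁻ w : ℂ, (if R < ‖z - w‖ then ENNReal.ofReal ‖z - w‖⁻¹ else 0) *
      g w ≤ ENNReal.ofReal t) :
    volume {z | ENNReal.ofReal (3 * t) < rieszPotential g z} ≤
      ENNReal.ofReal (2 * Real.pi * R / t) *
        ∫⁻ w, (if ENNReal.ofReal (t / (2 * Real.pi * R)) < g w then g w else 0) := by
  set h : ℝ := t / (2 * Real.pi * R) with hh
  have hpi := Real.pi_pos
  set G : ℂ → ℝ≥0∞ := fun w => if ENNReal.ofReal h < g w then g w else 0 with hG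
  have hGm : Measurable G :=
    Measurable.ite (measurableSet_lt (by fun_prop) hg) hg (by fun_prop)
  set N : ℂ → ℝ≥0∞ := fun z => ∫⁻ w : ℂ,
    (if ‖z - w‖ ≤ R then ENNReal.ofReal ‖z - w‖⁻¹ else 0) * G w with hN
  have hprod : Measurable (fun x : ℂ × ℂ =>
      (if ‖x.1 - x.2‖ ≤ R then ENNReal.ofReal ‖x.1 - x.2‖⁻¹ else 0) * G x.2) :=
    (measurable_near R).mul (hGm.comp measurable_snd)
  have hNm : Measurable N := Measurable.lintegral_prod_right' hprod
  have hsplit : ∀ z, rieszPotential g z ≤ ENNReal.ofReal t + ENNReal.ofReal t + N z := by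
    intro z
    have hpt : ∀ w : ℂ, ENNReal.ofReal ‖z - w‖⁻¹ * g w ≤
        (if R < ‖z - w‖ then ENNReal.ofReal ‖z - w‖⁻¹ else 0) * g w +
        ((if ‖z - w‖ ≤ R then ENNReal.ofReal ‖z - w‖⁻¹ else 0) * ENNReal.ofReal h +
        (if ‖z - w‖ ≤ R then ENNReal.ofReal ‖z - w‖⁻¹ else 0) * G w) := by
      intro w
      rcases le_or_gt ‖z - w‖ R with h1 | h1
      · rw [if_pos h1, if_neg (not_lt.2 h1), zero_mul, zero_add, ← mul_add]
        gcongr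
        by_cases h2 : ENNReal.ofReal h < g w
        · simp [hG, h2]
        · exact (not_lt.1 h2).trans (le_add_right le_rfl)
      · rw [if_pos h1]
        exact le_add_right le_rfl
    refine (lintegral_mono hpt).trans ?_
    have hm1 : Measurable fun w : ℂ =>
        (if R < ‖z - w‖ then ENNReal.ofReal ‖z - w‖⁻¹ else 0) * g w :=
      (measurable_far_left R z).mul hg
    have hm2 : Measurable fun w : ℂ =>
        (if ‖z - w‖ ≤ R then ENNReal.ofReal ‖z - w‖⁻¹ else 0) * ENNReal.ofReal h :=
      (measurable_near_left R z).mul measurable_const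
    rw [lintegral_add_left hm1, lintegral_add_left hm2,
      lintegral_mul_const _ (measurable_near_left R z), lintegral_near_sub hR.le,
      ← ENNReal.ofReal_mul (by positivity), ← add_assoc]
    gcongr
    · exact hfar z
    · rw [hh, mul_div_cancel₀ _ (by positivity)]
  have hsub : {z | ENNReal.ofReal (3 * t) < rieszPotential g z} ⊆ {z | ENNReal.ofReal t ≤ N z} := by
    intro z hz
    by_contra hlt
    simp only [mem_ofPred_eq, not_le] at hlt hz
    refine absurd (hz.trans_le (hsplit z)) (not_lt.2 ?_)
    calc _ ≤ ENNReal.ofReal t + ENNReal.ofReal t + ENNReal.ofReal t := by gcongr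
      _ = _ := by
        rw [← ENNReal.ofReal_add ht.le ht.le, ← ENNReal.ofReal_add (by positivity) ht.le]
        congr 1
        ring
  refine (measure_mono hsub).trans ((meas_ge_le_lintegral_div hNm.aemeasurable
    (by simpa using ht) ENNReal.ofReal_ne_top).trans ?_)
  have hint : ∫⁻ z, N z = ENNReal.ofReal (2 * Real.pi * R) * ∫⁻ w, G w := by
    rw [hN, lintegral_lintegral_swap hprod.aemeasurable, ← lintegral_const_mul _ hGm]
    refine lintegral_congr fun w => ?_
    have e : ∀ z : ℂ, (if ‖z - w‖ ≤ R then ENNReal.ofReal ‖z - w‖⁻¹ else 0) =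
      (if ‖w - z‖ ≤ R then ENNReal.ofReal ‖w - z‖⁻¹ else 0) := fun z => by rw [norm_sub_rev]
    simp_rw [e]
    rw [lintegral_mul_const _ (measurable_near_left R w), lintegral_near_sub hR.le]
  rw [hint, ENNReal.ofReal_div_of_pos ht, ENNReal.mul_div_right_comm]

/-- The Hardy–Littlewood–Sobolev inequality for a normalised function: at the level `t`, the radius
`R(t)` makes the far part of the potential small and the height `t / (2πR(t))` makes the bounded part
of `g` contribute little, so that Chebyshev's inequality is needed only for the large values of `g`.
Integrating over `t` then reproduces `∫ g ^ p`. -/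
theorem hardyLittlewoodSobolev_of_le_one {p q : ℝ} (hp₁ : 1 < p) (hp₂ : p < 2)
    (hpq : 1 / p = 1 / 2 + 1 / q) :
    ∃ C : ℝ≥0, ∀ g : ℂ → ℝ≥0∞, Measurable g → ∫⁻ w, g w ^ p ≤ 1 →
      ∫⁻ z, rieszPotential g z ^ q ≤ C := by
  have hq2 : 2 < q := by
    have h1 : 1 / 2 < 1 / p := one_div_lt_one_div_of_lt (by linarith) hp₂
    have h2 : 1 / p < 1 := by rw [div_lt_one (by linarith)]; exact hp₁
    have h3 : 0 < 1 / q := by linarith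
    have h4 : 0 < q := one_div_pos.1 h3
    exact (one_div_lt_one_div h4 (by norm_num)).1 (by linarith)
  have hp0 : 0 < p := by linarith
  set m : ℝ := p / (p - 1) with hm
  have hmp : m.HolderConjugate p := (Real.HolderConjugate.conjExponent hp₁).symm
  have hm2 : 2 < m := by
    rw [hm, lt_div_iff₀ (by linarith)]; linarith
  set c : ℝ := (2 * Real.pi / (m - 2)) ^ (1 / m) with hc
  have hc0 : 0 < c := by
    have : 0 < m - 2 := by linarith
    positivity
  have hexp : (2 - m) / m = -(2 / q) := by
    have h1 : 1 / m = 1 - 1 / p := by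
      rw [hm]; field_simp
    have : (2 - m) / m = 2 * (1 / m) - 1 := by
      have : m ≠ 0 := by linarith
      field_simp
    rw [this, h1, hpq]
    ring
  set a : ℝ := q / 2 + 1 with ha
  set b : ℝ := q / 2 - 1 with hb
  have ha0 : 0 < a := by rw [ha]; linarith
  have hb0 : 0 < b := by rw [hb]; linarith
  have hpab : p = 1 + b / a := by
    have h1 : p * (q + 2) = 2 * q := by
      have : q ≠ 0 := by linarith
      field_simp at hpq
      linarith
    rw [ha, hb]
    have : q / 2 + 1 ≠ 0 := by linarith
    field_simp
    linarith
  set D : ℝ := 2 * Real.pi * c ^ (q / 2) with hD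
  have hD0 : 0 < D := by positivity
  -- the radius is chosen so that the far part of the potential is at most `t`
  let R : ℝ → ℝ := fun t => (t / c) ^ (-(q / 2))
  have hlevel : ∀ g : ℂ → ℝ≥0∞, Measurable g → ∫⁻ w, g w ^ p ≤ 1 → ∀ t : ℝ, 0 < t →
      volume {z | ENNReal.ofReal (3 * t) < rieszPotential g z} ≤
      ENNReal.ofReal (D * t ^ (-(q / 2) - 1)) *
        ∫⁻ w, (if ENNReal.ofReal t < (ENNReal.ofReal D * g w) ^ a⁻¹ then g w else 0) := by
    intro g hg hg1 t ht
    have hR : 0 < R t := Real.rpow_pos_of_pos (by positivity) _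
    have hRt : R t = t ^ (-(q / 2)) * c ^ (q / 2) := by
      simp only [R]
      rw [Real.div_rpow ht.le hc0.le, Real.rpow_neg hc0.le, div_inv_eq_mul]
    have h1 := volume_lt_rieszPotential_le hg ht hR (fun z => by
      refine (lintegral_far_mul_le hmp hm2 hR hg hg1 z).trans (le_of_eq ?_)
      congr 1
      simp only [R]
      rw [← hc, hexp, ← Real.rpow_mul (by positivity),
        show -(q / 2) * -(2 / q) = 1 by field_simp, Real.rpow_one, mul_div_cancel₀ _ hc0.ne'])
    have e1 : 2 * Real.pi * R t / t = D * t ^ (-(q / 2) - 1) := by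
      rw [hRt, Real.rpow_sub_one ht.ne', hD]
      ring
    have e2 : ∀ w, ENNReal.ofReal (t / (2 * Real.pi * R t)) < g w ↔
        ENNReal.ofReal t < (ENNReal.ofReal D * g w) ^ a⁻¹ := by
      intro w
      rw [ENNReal.lt_rpow_inv_iff ha0, ENNReal.ofReal_rpow_of_nonneg ht.le ha0.le,
        mul_comm (ENNReal.ofReal D),
        ← ENNReal.div_lt_iff (Or.inl (by simpa using hD0)) (Or.inl ENNReal.ofReal_ne_top),
        ← ENNReal.ofReal_div_of_pos hD0]
      have : t / (2 * Real.pi * R t) = t ^ a / D := by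
        rw [hRt, hD, ha, Real.rpow_add_one ht.ne', Real.rpow_neg ht.le]
        field_simp
      rw [this]
    rw [e1] at h1
    simp_rw [e2] at h1
    exact h1
  refine ⟨(3 ^ q * q * D * b⁻¹ * D ^ (b / a)).toNNReal, fun g hg hg1 => ?_⟩
  have hI := measurable_rieszPotential hg
  have hlt : ∀ t z, ENNReal.ofReal t < rieszPotential g z / 3 ↔
      ENNReal.ofReal (3 * t) < rieszPotential g z := by
    intro t z
    rw [ENNReal.lt_div_iff_mul_lt (by simp) (by simp), ENNReal.ofReal_mul (by norm_num), mul_comm]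
    simp
  have hcake : ∀ z, rieszPotential g z ^ q = ENNReal.ofReal (3 ^ q * q) *
      ∫⁻ t in Ioi (0 : ℝ), (if ENNReal.ofReal (3 * t) < rieszPotential g z then
        ENNReal.ofReal (t ^ (q - 1)) else 0) := by
    intro z
    have := lintegral_rpow_of_lt (m := q) (by linarith) (rieszPotential g z / 3)
    simp_rw [hlt] at this
    have h3 : (3 : ℝ≥0∞) = ENNReal.ofReal 3 := by simp
    have hqq : 3 ^ q * q * q⁻¹ = (3 : ℝ) ^ q := by
      have : q ≠ 0 := by linarith
      field_simp
    rw [this, ← mul_assoc, ← ENNReal.ofReal_mul (by positivity), hqq,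
      ← ENNReal.ofReal_rpow_of_nonneg (by norm_num) (by linarith), ← h3,
      ← ENNReal.mul_rpow_of_nonneg _ _ (by linarith),
      ENNReal.mul_div_cancel (by simp) (by simp)]
  have hm1 : Measurable (fun x : ℂ × ℝ => if ENNReal.ofReal (3 * x.2) < rieszPotential g x.1 then
        ENNReal.ofReal (x.2 ^ (q - 1)) else 0) :=
    Measurable.ite (measurableSet_lt (by fun_prop) (by fun_prop)) (by fun_prop) (by fun_prop)
  have hm2 : Measurable (fun x : ℝ × ℂ =>
      ENNReal.ofReal (x.1 ^ (b - 1)) *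
        if ENNReal.ofReal x.1 < (ENNReal.ofReal D * g x.2) ^ a⁻¹ then g x.2 else 0) := by
    refine Measurable.mul (by fun_prop) ?_
    exact Measurable.ite (measurableSet_lt (by fun_prop) (by fun_prop)) (by fun_prop) (by fun_prop)
  calc ∫⁻ z, rieszPotential g z ^ q
      = ENNReal.ofReal (3 ^ q * q) * ∫⁻ t in Ioi (0 : ℝ), ∫⁻ z,
        (if ENNReal.ofReal (3 * t) < rieszPotential g z then
        ENNReal.ofReal (t ^ (q - 1)) else 0) := by
        simp_rw [hcake]
        rw [lintegral_const_mul _ (Measurable.lintegral_prod_right' hm1),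
          lintegral_lintegral_swap hm1.aemeasurable]
    _ ≤ ENNReal.ofReal (3 ^ q * q) * ∫⁻ t in Ioi (0 : ℝ), ENNReal.ofReal D *
        ∫⁻ w, ENNReal.ofReal (t ^ (b - 1)) *
          (if ENNReal.ofReal t < (ENNReal.ofReal D * g w) ^ a⁻¹ then g w else 0) := by
        refine mul_le_mul_right (setLIntegral_mono' measurableSet_Ioi fun t ht => ?_) _
        have ht0 : 0 < t := ht
        have e : ∫⁻ z, (if ENNReal.ofReal (3 * t) < rieszPotential g z then
            ENNReal.ofReal (t ^ (q - 1)) else 0) = ENNReal.ofReal (t ^ (q - 1)) *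
            volume {z | ENNReal.ofReal (3 * t) < rieszPotential g z} := by
          rw [← lintegral_indicator_const (measurableSet_lt measurable_const hI)]
          refine lintegral_congr fun z => ?_
          simp [indicator]
        rw [e, lintegral_const_mul, ← mul_assoc, ← ENNReal.ofReal_mul hD0.le]
        · refine (mul_le_mul_right (hlevel g hg hg1 t ht0) _).trans (le_of_eq ?_)
          rw [← mul_assoc, ← ENNReal.ofReal_mul (by positivity)]
          congr 2
          rw [mul_left_comm, ← Real.rpow_add ht0]
          congr 2
          rw [hb]; ring
        · exact Measurable.ite (measurableSet_lt (by fun_prop) (by fun_prop)) hg (by fun_prop)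
    _ = ENNReal.ofReal (3 ^ q * q) * (ENNReal.ofReal D * ∫⁻ w, g w *
          ∫⁻ t in Ioi (0 : ℝ),
          (if ENNReal.ofReal t < (ENNReal.ofReal D * g w) ^ a⁻¹ then
            ENNReal.ofReal (t ^ (b - 1)) else 0)) := by
        rw [lintegral_const_mul _ (Measurable.lintegral_prod_right' hm2),
          lintegral_lintegral_swap hm2.aemeasurable]
        congr 2
        refine lintegral_congr fun w => ?_
        rw [← lintegral_const_mul]
        · refine lintegral_congr fun t => ?_
          split_ifs
          · rw [mul_comm]
          · simp
        · exact Measurable.ite (measurableSet_lt (by fun_prop) (by fun_prop)) (by fun_prop)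
            (by fun_prop)
    _ = ENNReal.ofReal (3 ^ q * q * D * b⁻¹ * D ^ (b / a)) * ∫⁻ w, g w ^ p := by
        simp_rw [lintegral_rpow_of_lt hb0]
        rw [← lintegral_const_mul _ (by fun_prop), ← lintegral_const_mul _ (by fun_prop),
          ← lintegral_const_mul _ (by fun_prop)]
        refine lintegral_congr fun w => ?_
        rw [← ENNReal.rpow_mul, inv_mul_eq_div,
          ENNReal.mul_rpow_of_nonneg _ _ (by positivity),
          ENNReal.ofReal_rpow_of_nonneg hD0.le (by positivity), hpab,
          ENNReal.rpow_add_of_nonneg _ _ zero_le_one (by positivity), ENNReal.rpow_one,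
          ENNReal.ofReal_mul (p := 3 ^ q * q * D * b⁻¹) (by positivity),
          ENNReal.ofReal_mul (p := 3 ^ q * q * D) (by positivity),
          ENNReal.ofReal_mul (p := 3 ^ q * q) (by positivity)]
        ring
    _ ≤ ENNReal.ofReal (3 ^ q * q * D * b⁻¹ * D ^ (b / a)) * 1 := by gcongr
    _ = _ := by rw [mul_one]; rfl

/-- The **Hardy–Littlewood–Sobolev inequality** for the Riesz potential of order one in the
plane. -/
theorem hardyLittlewoodSobolev {p q : ℝ} (hp₁ : 1 < p) (hp₂ : p < 2)
    (hpq : 1 / p = 1 / 2 + 1 / q) (hq : 0 < q) :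
    ∃ C : ℝ≥0, ∀ g : ℂ → ℝ≥0∞, AEMeasurable g →
      (∫⁻ z, rieszPotential g z ^ q) ^ (1 / q) ≤ C * (∫⁻ w, g w ^ p) ^ (1 / p) := by
  obtain ⟨C, hC⟩ := hardyLittlewoodSobolev_of_le_one hp₁ hp₂ hpq
  have hp0 : 0 < p := by linarith
  -- the constant is enlarged so that it does not vanish
  refine ⟨(C + 1) ^ (1 / q), fun g' hg' => ?_⟩
  obtain ⟨g, hg, hgg'⟩ := hg'
  rw [rieszPotential_congr hgg', lintegral_congr_ae
    (hgg'.mono fun w hw => (by rw [hw] : g' w ^ p = g w ^ p))]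
  set N : ℝ≥0∞ := (∫⁻ w, g w ^ p) ^ (1 / p) with hN
  have hNp : N ^ p = ∫⁻ w, g w ^ p := by
    rw [hN, ← ENNReal.rpow_mul, one_div_mul_cancel hp0.ne', ENNReal.rpow_one]
  rcases eq_or_ne N 0 with h0 | h0
  · have : g =ᵐ[volume] 0 := by
      rw [h0, ENNReal.zero_rpow_of_pos hp0] at hNp
      filter_upwards [(lintegral_eq_zero_iff (by fun_prop)).1 hNp.symm] with w hw
      simpa [hp0, hp0.not_gt] using hw
    rw [rieszPotential_congr this]
    simp [rieszPotential, hq]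
  rcases eq_or_ne N ⊤ with h1 | h1
  · rw [h1, ENNReal.mul_top]
    · exact le_top
    · simp only [ne_eq, ENNReal.coe_eq_zero]
      positivity
  have hscale : ∀ z, rieszPotential g z = N * rieszPotential (fun w => N⁻¹ * g w) z := by
    intro z
    unfold rieszPotential
    rw [← lintegral_const_mul _ (by fun_prop)]
    refine lintegral_congr fun w => ?_
    rw [mul_left_comm N, ← mul_assoc N, ENNReal.mul_inv_cancel h0 h1, one_mul]
  have hone : ∫⁻ w, (N⁻¹ * g w) ^ p ≤ 1 := by
    simp_rw [ENNReal.mul_rpow_of_nonneg _ _ hp0.le]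
    rw [lintegral_const_mul _ (by fun_prop), ← hNp, ← ENNReal.mul_rpow_of_nonneg _ _ hp0.le,
      ENNReal.inv_mul_cancel h0 h1, ENNReal.one_rpow]
  have := hC _ (by fun_prop) hone
  simp_rw [hscale, ENNReal.mul_rpow_of_nonneg _ _ hq.le]
  rw [lintegral_const_mul _ (by fun_prop), ENNReal.mul_rpow_of_nonneg _ _ (by positivity),
    ← ENNReal.rpow_mul, mul_one_div_cancel hq.ne', ENNReal.rpow_one, mul_comm]
  gcongr
  rw [ENNReal.coe_rpow_of_nonneg _ (by positivity)]
  gcongr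
  refine this.trans ?_
  exact_mod_cast le_add_of_nonneg_right zero_le_one

/-! ### Regularised Cauchy kernels and the phase -/

/-- The regularised reciprocal norm `1 / √(|x|² + s²)`. -/
noncomputable def regNorm (s : ℝ) (x : ℂ) : ℝ := (√(‖x‖ ^ 2 + s ^ 2))⁻¹

/-- The smooth function `conj (l x) / (|x|² + s²)`, which regularises the singular kernel
`1 / l x` at scale `s`; here `l` is the identity or complex conjugation in the application. -/
noncomputable def regInv (l : ℂ ≃ₗᵢ[ℝ] ℂ) (s : ℝ) (x : ℂ) : ℂ :=
  (‖x‖ ^ 2 + s ^ 2)⁻¹ • conj (l x)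

theorem regNorm_nonneg (s : ℝ) (x : ℂ) : 0 ≤ regNorm s x := by
  unfold regNorm; positivity

theorem regNorm_sq (s : ℝ) (x : ℂ) : regNorm s x ^ 2 = (‖x‖ ^ 2 + s ^ 2)⁻¹ := by
  unfold regNorm
  rw [inv_pow, Real.sq_sqrt (by positivity)]

theorem regNorm_le_inv_norm (s : ℝ) {x : ℂ} (hx : x ≠ 0) : regNorm s x ≤ ‖x‖⁻¹ := by
  unfold regNorm
  have : 0 < ‖x‖ := norm_pos_iff.2 hx
  gcongr
  exact Real.le_sqrt_of_sq_le (by nlinarith [sq_nonneg s])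

theorem regNorm_le_inv {s : ℝ} (hs : 0 < s) (x : ℂ) : regNorm s x ≤ s⁻¹ := by
  unfold regNorm
  gcongr
  exact Real.le_sqrt_of_sq_le (by nlinarith [sq_nonneg ‖x‖])

theorem regNorm_anti {s : ℝ} (hs : 0 < s) {x y : ℂ} (h : ‖x‖ ≤ ‖y‖) :
    regNorm s y ≤ regNorm s x := by
  unfold regNorm
  gcongr

theorem cubicBump_eq (s : ℝ) (x : ℂ) : cubicBump s x = ‖x‖⁻¹ * regNorm s x ^ 2 := by
  rw [cubicBump, regNorm_sq, mul_inv]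

theorem regNorm_pow_three_le (s : ℝ) {x : ℂ} (hx : x ≠ 0) : regNorm s x ^ 3 ≤ cubicBump s x := by
  rw [cubicBump_eq, pow_succ']
  gcongr
  exact regNorm_le_inv_norm s hx

/-- A product of decreasing functions of the distances to two points is at most the sum of the
same products with both distances measured from one of the points. -/
theorem regNorm_sq_mul_inv_norm_le {s : ℝ} (hs : 0 < s) {x y : ℂ} (hx : x ≠ 0) (hy : y ≠ 0) :
    regNorm s x ^ 2 * ‖y‖⁻¹ ≤ cubicBump s x + cubicBump s y := by
  have hx' : 0 < ‖x‖ := norm_pos_iff.2 hx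
  have hy' : 0 < ‖y‖ := norm_pos_iff.2 hy
  rcases le_total ‖x‖ ‖y‖ with h | h
  · refine le_add_of_le_of_nonneg ?_ (cubicBump_nonneg s y)
    rw [cubicBump_eq, mul_comm]
    gcongr
  · refine le_add_of_nonneg_of_le (cubicBump_nonneg s x) ?_
    rw [cubicBump_eq, mul_comm]
    gcongr
    · exact regNorm_nonneg s x
    · exact regNorm_anti hs h

theorem regNorm_mul_mul_le (s : ℝ) {x y w : ℂ} (hx : x ≠ 0) (hy : y ≠ 0) (hw : w ≠ 0) :
    regNorm s x * regNorm s y * regNorm s w ≤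
      cubicBump s x + cubicBump s y + cubicBump s w := by
  have h1 := regNorm_pow_three_le s hx
  have h2 := regNorm_pow_three_le s hy
  have h3 := regNorm_pow_three_le s hw
  have a := regNorm_nonneg s x
  have b := regNorm_nonneg s y
  have c := regNorm_nonneg s w
  generalize regNorm s x = A at *
  generalize regNorm s y = B at *
  generalize regNorm s w = D at *
  have : A * B * D ≤ A ^ 3 + B ^ 3 + D ^ 3 := by
    nlinarith [mul_nonneg (add_nonneg (add_nonneg a b) c)
      (add_nonneg (add_nonneg (sq_nonneg (A - B)) (sq_nonneg (B - D))) (sq_nonneg (A - D))),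
      mul_nonneg (mul_nonneg a b) c]
  linarith

theorem inv_mul_inv_le_of_le_add {a b d : ℝ} (ha : 0 < a) (hb : 0 < b) (hd : 0 < d)
    (h : d ≤ a + b) : a⁻¹ * b⁻¹ ≤ d⁻¹ * (a⁻¹ + b⁻¹) := by
  have : a⁻¹ + b⁻¹ = (a + b) * (a⁻¹ * b⁻¹) := by field_simp; ring
  rw [this, ← mul_assoc]
  refine le_mul_of_one_le_left (by positivity) ?_
  rw [inv_mul_eq_div, one_le_div hd]
  exact h

theorem regNorm_mul_regNorm_le {s : ℝ} (hs : 0 < s) {x y : ℂ} {d : ℝ} (hd : 0 < d)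
    (h : d ≤ ‖x‖ + ‖y‖) : regNorm s x * regNorm s y ≤ d⁻¹ * (regNorm s x + regNorm s y) := by
  unfold regNorm
  refine inv_mul_inv_le_of_le_add (by positivity) (by positivity) hd (h.trans ?_)
  gcongr <;> exact Real.le_sqrt_of_sq_le (by nlinarith [sq_nonneg s])

theorem norm_regInv_le {s : ℝ} (hs : 0 < s) (l : ℂ ≃ₗᵢ[ℝ] ℂ) (x : ℂ) :
    ‖regInv l s x‖ ≤ regNorm s x := by
  unfold regInv
  rw [← regNorm_sq, norm_smul, RCLike.norm_conj, LinearIsometryEquiv.norm_map, norm_pow,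
    Real.norm_of_nonneg (regNorm_nonneg s x), pow_two, mul_assoc]
  refine mul_le_of_le_one_right (regNorm_nonneg s x) ?_
  unfold regNorm
  rw [inv_mul_le_one₀ (by positivity)]
  exact Real.le_sqrt_of_sq_le (by nlinarith [sq_nonneg s])

theorem norm_inv_sub_regInv_le {s : ℝ} (hs : 0 < s) (l : ℂ ≃ₗᵢ[ℝ] ℂ) {x : ℂ} (hx : x ≠ 0) :
    ‖(l x)⁻¹ - regInv l s x‖ ≤ s ^ 2 * cubicBump s x := by
  have hx' : 0 < ‖x‖ := norm_pos_iff.2 hx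
  have h1 : (l x)⁻¹ = (‖x‖ ^ 2)⁻¹ • conj (l x) := by
    rw [Complex.inv_def, Complex.normSq_eq_norm_sq, LinearIsometryEquiv.norm_map, mul_comm,
      Complex.real_smul]
  rw [h1, regInv, ← sub_smul, norm_smul, RCLike.norm_conj, LinearIsometryEquiv.norm_map]
  have h2 : (‖x‖ ^ 2)⁻¹ - (‖x‖ ^ 2 + s ^ 2)⁻¹ = s ^ 2 * ((‖x‖ ^ 2)⁻¹ * (‖x‖ ^ 2 + s ^ 2)⁻¹) := by
    field_simp
    ring
  rw [h2, Real.norm_of_nonneg (by positivity), cubicBump]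
  apply le_of_eq
  field_simp

theorem hasFDerivAt_regInv {s : ℝ} (hs : 0 < s) (l : ℂ ≃ₗᵢ[ℝ] ℂ) (x : ℂ) :
    ∃ D : ℂ →L[ℝ] ℂ, HasFDerivAt (regInv l s) D x ∧ ‖D‖ ≤ 3 * regNorm s x ^ 2 := by
  set L : ℂ →L[ℝ] ℂ := (Complex.conjLIE.toContinuousLinearEquiv : ℂ →L[ℝ] ℂ).comp
    (l.toContinuousLinearEquiv : ℂ →L[ℝ] ℂ) with hL
  have hLx : ∀ y, L y = conj (l y) := fun y => rfl
  have hLn : ∀ y, ‖L y‖ = ‖y‖ := fun y => by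
    rw [hLx, RCLike.norm_conj, LinearIsometryEquiv.norm_map]
  have hpos : 0 < ‖x‖ ^ 2 + s ^ 2 := by positivity
  have h1 : HasFDerivAt (fun y : ℂ => ‖y‖ ^ 2 + s ^ 2) (2 • (innerSL ℝ x)) x :=
    (hasStrictFDerivAt_norm_sq x).hasFDerivAt.add_const _
  have h2 := ((hasDerivAt_inv hpos.ne').comp_hasFDerivAt x h1).smul (L.hasFDerivAt (x := x))
  refine ⟨_, h2, ?_⟩
  rw [regNorm_sq]
  refine ContinuousLinearMap.opNorm_le_bound _ (by positivity) fun v => ?_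
  simp only [add_apply, smul_apply, ContinuousLinearMap.smulRight_apply, Function.comp_apply]
  set ρ := ‖x‖ ^ 2 + s ^ 2 with hρ
  have hxρ : ‖x‖ ^ 2 ≤ ρ := by rw [hρ]; nlinarith [sq_nonneg s]
  refine (norm_add_le _ _).trans ?_
  rw [norm_smul, norm_smul, hLn, hLn, norm_smul]
  have h3 : ‖2 • (innerSL ℝ x) v‖ ≤ 2 * (‖x‖ * ‖v‖) := by
    rw [nsmul_eq_mul, norm_mul]
    gcongr
    · simp
    · exact norm_inner_le_norm x v
  have h4 : ‖-(ρ ^ 2)⁻¹‖ = (ρ ^ 2)⁻¹ := by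
    rw [norm_neg, Real.norm_of_nonneg (by positivity)]
  rw [h4, Real.norm_of_nonneg (by positivity)]
  calc _ ≤ ρ⁻¹ * ‖v‖ + (ρ ^ 2)⁻¹ * (2 * (‖x‖ * ‖v‖)) * ‖x‖ := by gcongr
    _ = ρ⁻¹ * ‖v‖ + 2 * (ρ ^ 2)⁻¹ * ‖v‖ * ‖x‖ ^ 2 := by ring
    _ ≤ ρ⁻¹ * ‖v‖ + 2 * (ρ ^ 2)⁻¹ * ‖v‖ * ρ := by gcongr
    _ = 3 * ρ⁻¹ * ‖v‖ := by field_simp; ring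

theorem contDiff_regInv {s : ℝ} (hs : 0 < s) (l : ℂ ≃ₗᵢ[ℝ] ℂ) : ContDiff ℝ 1 (regInv l s) := by
  unfold regInv
  refine ContDiff.smul (ContDiff.inv ((contDiff_norm_sq ℝ).add contDiff_const) ?_) ?_
  · intro x
    positivity
  · exact (Complex.conjLIE.toContinuousLinearEquiv.contDiff).comp
      l.toContinuousLinearEquiv.contDiff

theorem norm_fderiv_regInv_le {s : ℝ} (hs : 0 < s) (l : ℂ ≃ₗᵢ[ℝ] ℂ) (x : ℂ) :
    ‖fderiv ℝ (regInv l s) x‖ ≤ 3 * regNorm s x ^ 2 := by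
  obtain ⟨D, hD, hb⟩ := hasFDerivAt_regInv hs l x
  rwa [hD.fderiv]

theorem norm_fderiv_mul_le {f g : ℂ → ℂ} {x : ℂ} (hf : DifferentiableAt ℝ f x)
    (hg : DifferentiableAt ℝ g x) :
    ‖fderiv ℝ (fun y => f y * g y) x‖ ≤ ‖f x‖ * ‖fderiv ℝ g x‖ + ‖fderiv ℝ f x‖ * ‖g x‖ := by
  rw [fderiv_fun_mul hf hg]
  refine (norm_add_le _ _).trans ?_
  rw [norm_smul, norm_smul, mul_comm ‖g x‖]

/-- Twice the operator `∂̄`. -/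
noncomputable def dbarTwo (f : ℂ → ℂ) (ζ : ℂ) : ℂ :=
  fderiv ℝ f ζ 1 + Complex.I * fderiv ℝ f ζ Complex.I

theorem norm_dbarTwo_le (f : ℂ → ℂ) (ζ : ℂ) : ‖dbarTwo f ζ‖ ≤ 2 * ‖fderiv ℝ f ζ‖ := by
  unfold dbarTwo
  refine (norm_add_le _ _).trans ?_
  rw [norm_mul, Complex.norm_I, one_mul, two_mul]
  have h1 := (fderiv ℝ f ζ).le_opNorm 1
  have h2 := (fderiv ℝ f ζ).le_opNorm Complex.I
  rw [norm_one, mul_one] at h1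
  rw [Complex.norm_I, mul_one] at h2
  gcongr

theorem continuous_dbarTwo {f : ℂ → ℂ} (hf : ContDiff ℝ 1 f) : Continuous (dbarTwo f) := by
  have := hf.continuous_fderiv one_ne_zero
  unfold dbarTwo
  fun_prop

theorem integral_dbarTwo_mul {f g : ℂ → ℂ} (hf : ContDiff ℝ 1 f) (hg : ContDiff ℝ 1 g)
    (hgc : HasCompactSupport g) :
    ∫ ζ, dbarTwo f ζ * g ζ = -∫ ζ, f ζ * dbarTwo g ζ := by
  have hfc := hf.continuous
  have hgcont := hg.continuous
  have hf' := hf.continuous_fderiv one_ne_zero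
  have hg' := hg.continuous_fderiv one_ne_zero
  have i1 : ∀ v : ℂ, Integrable fun ζ => fderiv ℝ f ζ v * g ζ := fun v =>
    Continuous.integrable_of_hasCompactSupport (by fun_prop) hgc.mul_left
  have i2 : ∀ v : ℂ, Integrable fun ζ => f ζ * fderiv ℝ g ζ v := fun v =>
    Continuous.integrable_of_hasCompactSupport (by fun_prop) (hgc.fderiv_apply ℝ v).mul_left
  have i3 : Integrable fun ζ => f ζ * g ζ :=
    Continuous.integrable_of_hasCompactSupport (by fun_prop) hgc.mul_left
  have key : ∀ v : ℂ, ∫ ζ, f ζ * fderiv ℝ g ζ v = -∫ ζ, fderiv ℝ f ζ v * g ζ := fun v =>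
    integral_mul_fderiv_eq_neg_fderiv_mul_of_integrable (i1 v) (i2 v) i3
      (fun x _ => hf.differentiable one_ne_zero x) (fun x _ => hg.differentiable one_ne_zero x)
  have e1 : ∀ ζ, dbarTwo f ζ * g ζ =
      fderiv ℝ f ζ 1 * g ζ + Complex.I * (fderiv ℝ f ζ Complex.I * g ζ) := fun ζ => by
    unfold dbarTwo; ring
  have e2 : ∀ ζ, f ζ * dbarTwo g ζ =
      f ζ * fderiv ℝ g ζ 1 + Complex.I * (f ζ * fderiv ℝ g ζ Complex.I) := fun ζ => by
    unfold dbarTwo; ring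
  simp_rw [e1, e2]
  rw [integral_add (i1 1) ((i1 _).const_mul _), integral_add (i2 1) ((i2 _).const_mul _),
    integral_const_mul, integral_const_mul, key, key]
  ring

theorem norm_osc (τ : ℝ) (z₀ z : ℂ) : ‖osc τ z₀ z‖ = 1 := by
  unfold osc
  rw [Complex.add_conj, Complex.norm_exp]
  simp

theorem hasFDerivAt_osc (τ : ℝ) (z₀ ζ : ℂ) : ∃ D : ℂ →L[ℝ] ℂ, HasFDerivAt (osc τ z₀) D ζ ∧
    ∀ v, D v = osc τ z₀ ζ * (Complex.I * τ * (2 * (ζ - z₀) * v + conj (2 * (ζ - z₀) * v))) := by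
  have h1 : HasDerivAt (phase z₀) (2 * (ζ - z₀)) ζ := by
    unfold phase
    simpa using ((hasDerivAt_id ζ).sub_const z₀).fun_pow 2
  have h2 := h1.hasFDerivAt.restrictScalars ℝ
  have h3 := Complex.conjCLE.hasFDerivAt.comp ζ h2
  have h4 := ((h2.add h3).const_mul (Complex.I * (τ : ℂ))).cexp
  refine ⟨_, h4, fun v => ?_⟩
  simp [osc]
  ring

theorem contDiff_osc (τ : ℝ) (z₀ : ℂ) : ContDiff ℝ 1 (osc τ z₀) := by
  have h1 : ContDiff ℝ 1 (phase z₀) := by unfold phase; fun_prop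
  have h2 : ContDiff ℝ 1 fun z => conj (phase z₀ z) := Complex.conjCLE.contDiff.comp h1
  unfold osc
  fun_prop

theorem dbarTwo_osc (τ : ℝ) (z₀ ζ : ℂ) :
    dbarTwo (osc τ z₀) ζ = 4 * Complex.I * τ * conj (ζ - z₀) * osc τ z₀ ζ := by
  obtain ⟨D, hD, hv⟩ := hasFDerivAt_osc τ z₀ ζ
  unfold dbarTwo
  rw [hD.fderiv, hv, hv]
  simp only [map_mul, Complex.conj_I, map_one, map_ofNat]
  linear_combination (osc τ z₀ ζ * Complex.I * τ * (2 * (ζ - z₀) - 2 * conj (ζ - z₀))) *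
    Complex.I_sq

/-! ### The oscillatory kernel estimate -/

/-- The kernel `∫ φ(ζ) / (l₁ (z - ζ) l₂ (ζ - w)) dζ` of the composition of two Cauchy operators
with multiplication by `φ` in between. -/
noncomputable def crossKernel (l₁ l₂ : ℂ ≃ₗᵢ[ℝ] ℂ) (φ : ℂ → ℂ) (z w : ℂ) : ℂ :=
  ∫ ζ : ℂ, (l₁ (z - ζ))⁻¹ * φ ζ * (l₂ (ζ - w))⁻¹

section Pointwise

variable {s d : ℝ} {x y w : ℂ}

theorem cubicBump_mul_inv_norm_le (hs : 0 < s) (hd : 0 < d) (hx : x ≠ 0) (hy : y ≠ 0)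
    (h : d ≤ ‖x‖ + ‖y‖) :
    cubicBump s x * ‖y‖⁻¹ ≤ d⁻¹ * (2 * (cubicBump s x + cubicBump s y)) := by
  have h1 := inv_mul_inv_le_of_le_add (norm_pos_iff.2 hx) (norm_pos_iff.2 hy) hd h
  have h2 := regNorm_sq_mul_inv_norm_le hs hx hy
  have h3 := cubicBump_nonneg s y
  calc cubicBump s x * ‖y‖⁻¹ = regNorm s x ^ 2 * (‖x‖⁻¹ * ‖y‖⁻¹) := by rw [cubicBump_eq]; ring
    _ ≤ regNorm s x ^ 2 * (d⁻¹ * (‖x‖⁻¹ + ‖y‖⁻¹)) := by gcongr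
    _ = d⁻¹ * (cubicBump s x + regNorm s x ^ 2 * ‖y‖⁻¹) := by rw [cubicBump_eq]; ring
    _ ≤ _ := by gcongr; linarith

theorem regNorm_mul_regNorm_mul_sq_le (hs : 0 < s) (hd : 0 < d) (hx : x ≠ 0) (hy : y ≠ 0)
    (hw : w ≠ 0) (h : d ≤ ‖x‖ + ‖y‖) :
    regNorm s x * regNorm s y * regNorm s w ^ 2 ≤
      d⁻¹ * (2 * (cubicBump s x + cubicBump s y + cubicBump s w)) := by
  have h1 := regNorm_mul_regNorm_le hs hd h
  have h2 := regNorm_sq_mul_inv_norm_le hs hw hx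
  have h3 := regNorm_sq_mul_inv_norm_le hs hw hy
  have h4 := regNorm_le_inv_norm s hx
  have h5 := regNorm_le_inv_norm s hy
  have h6 := cubicBump_nonneg s x
  have h7 := cubicBump_nonneg s y
  calc regNorm s x * regNorm s y * regNorm s w ^ 2
      ≤ d⁻¹ * (regNorm s x + regNorm s y) * regNorm s w ^ 2 := by gcongr
    _ ≤ d⁻¹ * (‖x‖⁻¹ + ‖y‖⁻¹) * regNorm s w ^ 2 := by gcongr
    _ = d⁻¹ * (regNorm s w ^ 2 * ‖x‖⁻¹ + regNorm s w ^ 2 * ‖y‖⁻¹) := by ring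
    _ ≤ _ := by gcongr; linarith

theorem regNorm_sq_mul_regNorm_mul_le (hs : 0 < s) (hd : 0 < d) (hx : x ≠ 0) (hy : y ≠ 0)
    (hw : w ≠ 0) (h : d ≤ ‖x‖ + ‖y‖) :
    regNorm s x ^ 2 * regNorm s y * regNorm s w ≤
      d⁻¹ * (2 * (cubicBump s x + cubicBump s y + cubicBump s w)) := by
  have h1 := regNorm_mul_regNorm_le hs hd h
  have h2 := regNorm_sq_mul_inv_norm_le hs hx hw
  have h3 := regNorm_mul_mul_le s hx hy hw
  have h4 := regNorm_le_inv_norm s hw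
  have h5 := regNorm_nonneg s x
  have h6 := regNorm_nonneg s w
  have h7 := cubicBump_nonneg s y
  calc regNorm s x ^ 2 * regNorm s y * regNorm s w
      = regNorm s x * regNorm s w * (regNorm s x * regNorm s y) := by ring
    _ ≤ regNorm s x * regNorm s w * (d⁻¹ * (regNorm s x + regNorm s y)) := by gcongr
    _ = d⁻¹ * (regNorm s x ^ 2 * regNorm s w + regNorm s x * regNorm s y * regNorm s w) := by ring
    _ ≤ d⁻¹ * (regNorm s x ^ 2 * ‖w‖⁻¹ + regNorm s x * regNorm s y * regNorm s w) := by gcongr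
    _ ≤ _ := by gcongr; linarith

theorem regNorm_mul_mul_le_inv (hs : 0 < s) (hd : 0 < d) (hx : x ≠ 0) (hy : y ≠ 0)
    (w : ℂ) (h : d ≤ ‖x‖ + ‖y‖) :
    regNorm s x * regNorm s y * regNorm s w ≤ d⁻¹ * (s⁻¹ * (‖x‖⁻¹ + ‖y‖⁻¹)) := by
  have h1 := regNorm_mul_regNorm_le hs hd h
  have h4 := regNorm_le_inv_norm s hx
  have h5 := regNorm_le_inv_norm s hy
  have h6 := regNorm_le_inv hs w
  have h7 := regNorm_nonneg s w
  calc regNorm s x * regNorm s y * regNorm s w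
      ≤ d⁻¹ * (regNorm s x + regNorm s y) * regNorm s w := by gcongr
    _ ≤ d⁻¹ * (‖x‖⁻¹ + ‖y‖⁻¹) * s⁻¹ := by gcongr
    _ = _ := by ring

end Pointwise

theorem regInv_conjLIE_mul_conj {s : ℝ} (hs : 0 < s) (x : ℂ) :
    regInv Complex.conjLIE s x * conj x = 1 - s ^ 2 * (regNorm s x ^ 2 : ℝ) := by
  have h : (‖x‖ ^ 2 + s ^ 2 : ℝ) ≠ 0 := by positivity
  have h2 : ((‖x‖ : ℂ) ^ 2 + (s : ℂ) ^ 2) ≠ 0 := by exact_mod_cast h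
  rw [regNorm_sq, regInv, Complex.real_smul]
  simp only [Complex.conjLIE_apply, Complex.conj_conj]
  rw [mul_assoc, Complex.mul_conj, Complex.normSq_eq_norm_sq]
  push_cast
  field_simp
  ring

section KernelBound

variable {χ : ℂ → ℂ} {M M' s d σ : ℝ} {z₀ z w ζ : ℂ}

/-- The smooth amplitude which remains after all three singularities of the integrand have been
regularised at scale `s`. -/
noncomputable def regAmplitude (l₁ l₂ : ℂ ≃ₗᵢ[ℝ] ℂ) (χ : ℂ → ℂ) (s : ℝ) (z₀ z w ζ : ℂ) : ℂ :=
  χ ζ * (regInv l₁ s (z - ζ) * (regInv l₂ s (ζ - w) * regInv Complex.conjLIE s (ζ - z₀)))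

theorem contDiff_regAmplitude (l₁ l₂ : ℂ ≃ₗᵢ[ℝ] ℂ) (hχ : ContDiff ℝ 1 χ) (hs : 0 < s)
    (z₀ z w : ℂ) : ContDiff ℝ 1 (regAmplitude l₁ l₂ χ s z₀ z w) := by
  have h1 := (contDiff_regInv hs l₁).comp (contDiff_const (c := z).sub contDiff_id)
  have h2 := (contDiff_regInv hs l₂).comp (contDiff_id.sub (contDiff_const (c := w)))
  have h3 := (contDiff_regInv hs Complex.conjLIE).comp (contDiff_id.sub (contDiff_const (c := z₀)))
  exact hχ.mul (h1.mul (h2.mul h3))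

theorem hasCompactSupport_regAmplitude (l₁ l₂ : ℂ ≃ₗᵢ[ℝ] ℂ) (hχ : HasCompactSupport χ) (s : ℝ)
    (z₀ z w : ℂ) : HasCompactSupport (regAmplitude l₁ l₂ χ s z₀ z w) :=
  hχ.mul_right

theorem norm_fderiv_regAmplitude_le (l₁ l₂ : ℂ ≃ₗᵢ[ℝ] ℂ) (hχ : ContDiff ℝ 1 χ) (hs : 0 < s) :
    ‖fderiv ℝ (regAmplitude l₁ l₂ χ s z₀ z w) ζ‖ ≤
      ‖fderiv ℝ χ ζ‖ * (regNorm s (z - ζ) * regNorm s (ζ - w) * regNorm s (ζ - z₀)) +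
      ‖χ ζ‖ * 3 * (regNorm s (z - ζ) ^ 2 * regNorm s (ζ - w) * regNorm s (ζ - z₀) +
        regNorm s (ζ - w) ^ 2 * regNorm s (z - ζ) * regNorm s (ζ - z₀) +
        regNorm s (z - ζ) * regNorm s (ζ - w) * regNorm s (ζ - z₀) ^ 2) := by
  set A : ℂ → ℂ := fun ζ => regInv l₁ s (z - ζ)
  set B : ℂ → ℂ := fun ζ => regInv l₂ s (ζ - w)
  set W : ℂ → ℂ := fun ζ => regInv Complex.conjLIE s (ζ - z₀)
  have hA : DifferentiableAt ℝ A ζ := ((contDiff_regInv hs l₁).comp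
    (contDiff_const (c := z).sub contDiff_id)).differentiable one_ne_zero ζ
  have hB : DifferentiableAt ℝ B ζ := ((contDiff_regInv hs l₂).comp
    (contDiff_id.sub (contDiff_const (c := w)))).differentiable one_ne_zero ζ
  have hW : DifferentiableAt ℝ W ζ := ((contDiff_regInv hs Complex.conjLIE).comp
    (contDiff_id.sub (contDiff_const (c := z₀)))).differentiable one_ne_zero ζ
  have nA : ‖A ζ‖ ≤ regNorm s (z - ζ) := norm_regInv_le hs _ _
  have nB : ‖B ζ‖ ≤ regNorm s (ζ - w) := norm_regInv_le hs _ _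
  have nW : ‖W ζ‖ ≤ regNorm s (ζ - z₀) := norm_regInv_le hs _ _
  have dA : ‖fderiv ℝ A ζ‖ ≤ 3 * regNorm s (z - ζ) ^ 2 := by
    obtain ⟨D, hD, hDn⟩ := hasFDerivAt_regInv hs l₁ (z - ζ)
    have h := hD.comp ζ ((hasFDerivAt_id (𝕜 := ℝ) ζ).const_sub z)
    rw [ContinuousLinearMap.comp_neg, ContinuousLinearMap.comp_id] at h
    have h' : fderiv ℝ A ζ = -D := h.fderiv
    rwa [h', norm_neg]
  have dB : ‖fderiv ℝ B ζ‖ ≤ 3 * regNorm s (ζ - w) ^ 2 := by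
    simp only [B]
    rw [fderiv_comp_sub]
    exact norm_fderiv_regInv_le hs _ _
  have dW : ‖fderiv ℝ W ζ‖ ≤ 3 * regNorm s (ζ - z₀) ^ 2 := by
    simp only [W]
    rw [fderiv_comp_sub]
    exact norm_fderiv_regInv_le hs _ _
  have e1 := norm_fderiv_mul_le hB hW
  have e2 := norm_fderiv_mul_le hA (hB.mul hW)
  have e3 := norm_fderiv_mul_le (hχ.differentiable one_ne_zero ζ) (hA.mul (hB.mul hW))
  simp only [Pi.mul_apply, norm_mul] at e2 e3
  have e1' : ‖fderiv ℝ (fun y => B y * W y) ζ‖ ≤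
      regNorm s (ζ - w) * (3 * regNorm s (ζ - z₀) ^ 2) +
      3 * regNorm s (ζ - w) ^ 2 * regNorm s (ζ - z₀) := e1.trans (by
    have := regNorm_nonneg s (ζ - w)
    gcongr)
  have e2' : ‖fderiv ℝ (fun y => A y * (B y * W y)) ζ‖ ≤
      regNorm s (z - ζ) * (regNorm s (ζ - w) * (3 * regNorm s (ζ - z₀) ^ 2) +
      3 * regNorm s (ζ - w) ^ 2 * regNorm s (ζ - z₀)) +
      3 * regNorm s (z - ζ) ^ 2 * (regNorm s (ζ - w) * regNorm s (ζ - z₀)) := e2.trans (by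
    have := regNorm_nonneg s (ζ - w)
    have := regNorm_nonneg s (z - ζ)
    have := e1'
    gcongr
    exact e1')
  have e3' := e3.trans (b := _) (c := ‖χ ζ‖ *
      (regNorm s (z - ζ) * (regNorm s (ζ - w) * (3 * regNorm s (ζ - z₀) ^ 2) +
      3 * regNorm s (ζ - w) ^ 2 * regNorm s (ζ - z₀)) +
      3 * regNorm s (z - ζ) ^ 2 * (regNorm s (ζ - w) * regNorm s (ζ - z₀))) +
      ‖fderiv ℝ χ ζ‖ * (regNorm s (z - ζ) * (regNorm s (ζ - w) * regNorm s (ζ - z₀)))) (by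
    have := regNorm_nonneg s (ζ - w)
    have := regNorm_nonneg s (z - ζ)
    gcongr
    exact e2')
  refine e3'.trans (le_of_eq ?_)
  ring

/-- The integrand of the oscillatory kernel differs from a `∂̄`-derivative of the phase times a
smooth amplitude by an absolutely small remainder. -/
theorem norm_remainder_le (l₁ l₂ : ℂ ≃ₗᵢ[ℝ] ℂ) (hs : 0 < s) (hσ : |σ| * s ^ 2 = 1)
    (hM : ‖χ ζ‖ ≤ M) (hd : 0 < d) (hdzw : d ≤ ‖z - w‖)
    (hz : z - ζ ≠ 0) (hw : ζ - w ≠ 0) (hz₀ : ζ - z₀ ≠ 0) :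
    ‖(l₁ (z - ζ))⁻¹ * (osc σ z₀ ζ * χ ζ) * (l₂ (ζ - w))⁻¹ -
      (4 * Complex.I * σ)⁻¹ * (dbarTwo (osc σ z₀) ζ * regAmplitude l₁ l₂ χ s z₀ z w ζ)‖ ≤
    M * s ^ 2 * d⁻¹ *
      (6 * (cubicBump s (z - ζ) + cubicBump s (ζ - w) + cubicBump s (ζ - z₀))) := by
  have hσ0 : (σ : ℂ) ≠ 0 := by
    rintro h
    rw [Complex.ofReal_eq_zero] at h
    simp [h] at hσ
  have htri : d ≤ ‖z - ζ‖ + ‖ζ - w‖ := hdzw.trans (norm_sub_le_norm_sub_add_norm_sub z ζ w)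
  have htri' : d ≤ ‖ζ - w‖ + ‖z - ζ‖ := by rwa [add_comm]
  have hW := regInv_conjLIE_mul_conj hs (ζ - z₀)
  have hid : (l₁ (z - ζ))⁻¹ * (osc σ z₀ ζ * χ ζ) * (l₂ (ζ - w))⁻¹ -
      (4 * Complex.I * σ)⁻¹ * (dbarTwo (osc σ z₀) ζ * regAmplitude l₁ l₂ χ s z₀ z w ζ) =
      osc σ z₀ ζ * χ ζ * (((l₁ (z - ζ))⁻¹ - regInv l₁ s (z - ζ)) * (l₂ (ζ - w))⁻¹ +
        regInv l₁ s (z - ζ) * ((l₂ (ζ - w))⁻¹ - regInv l₂ s (ζ - w)) +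
        regInv l₁ s (z - ζ) * regInv l₂ s (ζ - w) * (s ^ 2 * (regNorm s (ζ - z₀) ^ 2 : ℝ))) := by
    have hc : (4 * Complex.I * σ)⁻¹ * (dbarTwo (osc σ z₀) ζ * regAmplitude l₁ l₂ χ s z₀ z w ζ) =
        osc σ z₀ ζ * χ ζ * regInv l₁ s (z - ζ) * regInv l₂ s (ζ - w) *
        (regInv Complex.conjLIE s (ζ - z₀) * conj (ζ - z₀)) := by
      rw [dbarTwo_osc, regAmplitude]
      have : (4 * Complex.I * (σ : ℂ)) ≠ 0 := by simp [hσ0]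
      calc _ = ((4 * Complex.I * (σ : ℂ))⁻¹ * (4 * Complex.I * (σ : ℂ))) *
          (osc σ z₀ ζ * χ ζ * regInv l₁ s (z - ζ) * regInv l₂ s (ζ - w) *
          (regInv Complex.conjLIE s (ζ - z₀) * conj (ζ - z₀))) := by ring
        _ = _ := by rw [inv_mul_cancel₀ this, one_mul]
    rw [hc, hW]
    ring
  rw [hid, norm_mul, norm_mul, norm_osc, one_mul]
  have b1 := norm_inv_sub_regInv_le hs l₁ hz
  have b2 := norm_inv_sub_regInv_le hs l₂ hw
  have b3 := norm_regInv_le hs l₁ (z - ζ)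
  have b4 := norm_regInv_le hs l₂ (ζ - w)
  have b5 := regNorm_le_inv_norm s hz
  have c1 := cubicBump_mul_inv_norm_le hs hd hz hw htri
  have c2 := cubicBump_mul_inv_norm_le hs hd hw hz htri'
  have c3 := regNorm_mul_regNorm_mul_sq_le hs hd hz hw hz₀ htri
  have p1 := cubicBump_nonneg s (z - ζ)
  have p2 := cubicBump_nonneg s (ζ - w)
  have p3 := cubicBump_nonneg s (ζ - z₀)
  have p4 := regNorm_nonneg s (z - ζ)
  have n1 : ‖((l₁ (z - ζ))⁻¹ - regInv l₁ s (z - ζ)) * (l₂ (ζ - w))⁻¹‖ ≤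
      s ^ 2 * (cubicBump s (z - ζ) * ‖ζ - w‖⁻¹) := by
    rw [norm_mul, norm_inv, LinearIsometryEquiv.norm_map, ← mul_assoc]
    gcongr
  have n2 : ‖regInv l₁ s (z - ζ) * ((l₂ (ζ - w))⁻¹ - regInv l₂ s (ζ - w))‖ ≤
      s ^ 2 * (cubicBump s (ζ - w) * ‖z - ζ‖⁻¹) := by
    rw [norm_mul, mul_comm, ← mul_assoc]
    gcongr
    exact b3.trans b5
  have n3 : ‖regInv l₁ s (z - ζ) * regInv l₂ s (ζ - w) *
      (s ^ 2 * (regNorm s (ζ - z₀) ^ 2 : ℝ))‖ ≤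
      s ^ 2 * (regNorm s (z - ζ) * regNorm s (ζ - w) * regNorm s (ζ - z₀) ^ 2) := by
    rw [norm_mul, norm_mul, norm_mul, norm_pow, Complex.norm_real, Complex.norm_real,
      Real.norm_of_nonneg hs.le, Real.norm_of_nonneg (by positivity), mul_left_comm]
    gcongr
  have hsum := add_le_add (add_le_add c1 c2) c3
  have hM0 : 0 ≤ M := (norm_nonneg _).trans hM
  calc _ ≤ M * (s ^ 2 * (cubicBump s (z - ζ) * ‖ζ - w‖⁻¹) +
        s ^ 2 * (cubicBump s (ζ - w) * ‖z - ζ‖⁻¹) +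
        s ^ 2 * (regNorm s (z - ζ) * regNorm s (ζ - w) * regNorm s (ζ - z₀) ^ 2)) := by
        gcongr
        exact (norm_add₃_le).trans (add_le_add (add_le_add n1 n2) n3)
    _ = M * s ^ 2 * (cubicBump s (z - ζ) * ‖ζ - w‖⁻¹ + cubicBump s (ζ - w) * ‖z - ζ‖⁻¹ +
        regNorm s (z - ζ) * regNorm s (ζ - w) * regNorm s (ζ - z₀) ^ 2) := by ring
    _ ≤ M * s ^ 2 * (d⁻¹ * (6 *
        (cubicBump s (z - ζ) + cubicBump s (ζ - w) + cubicBump s (ζ - z₀)))) := by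
        gcongr
        refine hsum.trans ?_
        rw [← mul_add, ← mul_add]
        gcongr
        linarith
    _ = _ := by ring

/-- The `∂̄`-derivative of the amplitude; the derivative of the cutoff contributes the term
supported on `tsupport χ`. -/
theorem norm_dbarTwo_regAmplitude_le (l₁ l₂ : ℂ ≃ₗᵢ[ℝ] ℂ) (hχ : ContDiff ℝ 1 χ) (hs : 0 < s)
    (hM : ‖χ ζ‖ ≤ M) (hM' : ‖fderiv ℝ χ ζ‖ ≤ M') (hd : 0 < d) (hdzw : d ≤ ‖z - w‖)
    (hz : z - ζ ≠ 0) (hw : ζ - w ≠ 0) (hz₀ : ζ - z₀ ≠ 0) :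
    ‖dbarTwo (regAmplitude l₁ l₂ χ s z₀ z w) ζ‖ ≤
    M * d⁻¹ * (36 * (cubicBump s (z - ζ) + cubicBump s (ζ - w) + cubicBump s (ζ - z₀))) +
      (tsupport χ).indicator (fun ζ => 2 * M' * d⁻¹ * s⁻¹ * (‖z - ζ‖⁻¹ + ‖ζ - w‖⁻¹)) ζ := by
  have htri : d ≤ ‖z - ζ‖ + ‖ζ - w‖ := hdzw.trans (norm_sub_le_norm_sub_add_norm_sub z ζ w)
  have htri' : d ≤ ‖ζ - w‖ + ‖z - ζ‖ := by rwa [add_comm]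
  have hM0 : 0 ≤ M := (norm_nonneg _).trans hM
  have hM0' : 0 ≤ M' := (norm_nonneg _).trans hM'
  have c1 := regNorm_sq_mul_regNorm_mul_le hs hd hz hw hz₀ htri
  have c2 := regNorm_sq_mul_regNorm_mul_le hs hd hw hz hz₀ htri'
  have c3 := regNorm_mul_regNorm_mul_sq_le hs hd hz hw hz₀ htri
  have c4 := regNorm_mul_mul_le_inv hs hd hz hw (ζ - z₀) htri
  have hi : ‖fderiv ℝ χ ζ‖ * (regNorm s (z - ζ) * regNorm s (ζ - w) * regNorm s (ζ - z₀)) * 2 ≤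
      (tsupport χ).indicator (fun ζ => 2 * M' * d⁻¹ * s⁻¹ * (‖z - ζ‖⁻¹ + ‖ζ - w‖⁻¹)) ζ := by
    by_cases hmem : ζ ∈ tsupport χ
    · rw [indicator_of_mem hmem]
      have p1 := regNorm_nonneg s (z - ζ)
      have p2 := regNorm_nonneg s (ζ - w)
      have p3 := regNorm_nonneg s (ζ - z₀)
      calc _ ≤ M' * (d⁻¹ * (s⁻¹ * (‖z - ζ‖⁻¹ + ‖ζ - w‖⁻¹))) * 2 := by gcongr
        _ = _ := by ring
    · rw [indicator_of_notMem hmem, image_eq_zero_of_notMem_tsupport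
        (fun h => hmem (tsupport_fderiv_subset ℝ h)), norm_zero, zero_mul, zero_mul]
  have h1 := norm_dbarTwo_le (regAmplitude l₁ l₂ χ s z₀ z w) ζ
  have h2 := norm_fderiv_regAmplitude_le l₁ l₂ hχ hs (z₀ := z₀) (z := z) (w := w) (ζ := ζ)
  have h3 : ‖χ ζ‖ * 3 * (regNorm s (z - ζ) ^ 2 * regNorm s (ζ - w) * regNorm s (ζ - z₀) +
        regNorm s (ζ - w) ^ 2 * regNorm s (z - ζ) * regNorm s (ζ - z₀) +
        regNorm s (z - ζ) * regNorm s (ζ - w) * regNorm s (ζ - z₀) ^ 2) ≤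
      M * 3 * (d⁻¹ * (6 * (cubicBump s (z - ζ) + cubicBump s (ζ - w) + cubicBump s (ζ - z₀)))) := by
    gcongr
    · have p1 := regNorm_nonneg s (z - ζ)
      have p2 := regNorm_nonneg s (ζ - w)
      have p3 := regNorm_nonneg s (ζ - z₀)
      positivity
    · linarith
  linarith

/-- The Cauchy kernel is integrable over the support of the cutoff, uniformly in the pole. -/
theorem lintegral_indicator_inv_norm_le (S : Set ℂ) (hS : MeasurableSet S) (z : ℂ) :
    ∫⁻ ζ, ENNReal.ofReal (S.indicator (fun ζ => ‖ζ - z‖⁻¹) ζ) ≤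
      volume S + ENNReal.ofReal (2 * Real.pi) := by
  have h := setLIntegral_norm_sub_rpow_le (a := -1) (by norm_num) (by norm_num) S z
  simp only [Real.rpow_neg_one] at h
  norm_num at h
  refine le_trans (le_of_eq ?_) (h.trans_eq ?_)
  · rw [← lintegral_indicator hS]
    refine lintegral_congr fun ζ => ?_
    by_cases hζ : ζ ∈ S <;> simp [hζ]
  · rw [ENNReal.ofReal_mul (by norm_num)]
    simp

theorem lintegral_cubicBump_sub_le (hs : 0 < s) (z : ℂ) :
    ∫⁻ ζ, ENNReal.ofReal (cubicBump s (ζ - z)) ≤ ENNReal.ofReal (4 * Real.pi * s⁻¹) := by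
  rw [lintegral_sub_right_eq_self (fun ζ => ENNReal.ofReal (cubicBump s ζ)) z]
  exact lintegral_cubicBump_le hs

theorem cubicBump_sub_comm (s : ℝ) (z ζ : ℂ) : cubicBump s (z - ζ) = cubicBump s (ζ - z) := by
  unfold cubicBump; rw [norm_sub_rev]

/-- The kernel with the quadratic oscillation `exp (iσ(Φ + Φ̄))`, `|σ| = s⁻²`, gains a factor `s`
over a singularity of degree one, uniformly in the critical point `z₀`. -/
theorem enorm_crossKernel_osc_le (l₁ l₂ : ℂ ≃ₗᵢ[ℝ] ℂ) (hχ : ContDiff ℝ 1 χ)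
    (hχc : HasCompactSupport χ) (hM : ∀ ζ, ‖χ ζ‖ ≤ M) (hM' : ∀ ζ, ‖fderiv ℝ χ ζ‖ ≤ M')
    (hs : 0 < s) (hσ : |σ| * s ^ 2 = 1) (hzw : z ≠ w) :
    ‖crossKernel l₁ l₂ (fun ζ => osc σ z₀ ζ * χ ζ) z w‖ₑ ≤
      ENNReal.ofReal (s * ‖z - w‖⁻¹ *
        (180 * Real.pi * M + M' * ((volume (tsupport χ)).toReal + 2 * Real.pi))) := by
  set d := ‖z - w‖ with hd_def
  have hd : 0 < d := norm_pos_iff.2 (sub_ne_zero.2 hzw)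
  have hM0 : 0 ≤ M := (norm_nonneg _).trans (hM 0)
  have hM0' : 0 ≤ M' := (norm_nonneg _).trans (hM' 0)
  have hpi := Real.pi_pos
  set S := tsupport χ with hS
  have hSm : MeasurableSet S := (isClosed_tsupport χ).measurableSet
  have hSf : volume S ≠ ⊤ := hχc.measure_lt_top.ne
  set f : ℂ → ℂ := fun ζ => (l₁ (z - ζ))⁻¹ * (osc σ z₀ ζ * χ ζ) * (l₂ (ζ - w))⁻¹ with hf
  set G : ℂ → ℂ := regAmplitude l₁ l₂ χ s z₀ z w with hG
  have hGc : ContDiff ℝ 1 G := contDiff_regAmplitude l₁ l₂ hχ hs z₀ z w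
  have hGs : HasCompactSupport G := hasCompactSupport_regAmplitude l₁ l₂ hχc s z₀ z w
  have hE := contDiff_osc σ z₀
  set c : ℂ := (4 * Complex.I * σ)⁻¹ with hc
  have hcn : ‖c‖ = s ^ 2 / 4 := by
    rw [hc, norm_inv, norm_mul, norm_mul, Complex.norm_I, Complex.norm_real, Real.norm_eq_abs]
    have h0 : |σ| ≠ 0 := by
      intro h
      simp [h] at hσ
    have : s ^ 2 = |σ|⁻¹ := eq_inv_of_mul_eq_one_right hσ
    rw [this]
    norm_num
    field_simp
  change ‖∫ ζ, f ζ‖ₑ ≤ _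
  -- the integral of a non-integrable function is zero by convention
  by_cases hfi : Integrable f
  swap
  · rw [integral_undef hfi]; simp
  have hi1 : Integrable fun ζ => c * (dbarTwo (osc σ z₀) ζ * G ζ) := by
    refine Integrable.const_mul (Continuous.integrable_of_hasCompactSupport ?_ hGs.mul_left) c
    exact (continuous_dbarTwo hE).mul hGc.continuous
  have hdecomp : ∫ ζ, f ζ = (∫ ζ, (f ζ - c * (dbarTwo (osc σ z₀) ζ * G ζ))) -
      c * ∫ ζ, osc σ z₀ ζ * dbarTwo G ζ := by
    rw [integral_sub hfi hi1, integral_const_mul, integral_dbarTwo_mul hE hGc hGs]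
    ring
  have hae : ∀ᵐ ζ : ℂ, z - ζ ≠ 0 ∧ ζ - w ≠ 0 ∧ ζ - z₀ ≠ 0 := by
    have h : ∀ a : ℂ, ∀ᵐ ζ : ℂ, ζ ≠ a := fun a => by simp [ae_iff]
    filter_upwards [h z, h w, h z₀] with ζ h1 h2 h3
    exact ⟨sub_ne_zero.2 h1.symm, sub_ne_zero.2 h2, sub_ne_zero.2 h3⟩
  set H : ℂ → ℝ := fun ζ => cubicBump s (ζ - z) + cubicBump s (ζ - w) + cubicBump s (ζ - z₀)
    with hH
  have hHint : ∫⁻ ζ, ENNReal.ofReal (H ζ) ≤ ENNReal.ofReal (12 * Real.pi * s⁻¹) := by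
    have e : ∀ ζ, ENNReal.ofReal (H ζ) = ENNReal.ofReal (cubicBump s (ζ - z)) +
        ENNReal.ofReal (cubicBump s (ζ - w)) + ENNReal.ofReal (cubicBump s (ζ - z₀)) := by
      intro ζ
      rw [hH, ENNReal.ofReal_add (add_nonneg (cubicBump_nonneg _ _) (cubicBump_nonneg _ _))
        (cubicBump_nonneg _ _), ENNReal.ofReal_add (cubicBump_nonneg _ _) (cubicBump_nonneg _ _)]
    simp_rw [e]
    rw [lintegral_add_right _ (by fun_prop), lintegral_add_right _ (by fun_prop)]
    refine (add_le_add (add_le_add (lintegral_cubicBump_sub_le hs z)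
      (lintegral_cubicBump_sub_le hs w)) (lintegral_cubicBump_sub_le hs z₀)).trans_eq ?_
    rw [← ENNReal.ofReal_add (by positivity) (by positivity),
      ← ENNReal.ofReal_add (by positivity) (by positivity)]
    congr 1
    ring
  set I : ℂ → ℝ := S.indicator (fun ζ => ‖ζ - z‖⁻¹ + ‖ζ - w‖⁻¹) with hI
  have hI0 : ∀ ζ, 0 ≤ I ζ := fun ζ => indicator_nonneg (fun ζ _ => by positivity) ζ
  have hImeas : Measurable I := Measurable.indicator (by fun_prop) hSm
  have hIint : ∫⁻ ζ, ENNReal.ofReal (I ζ) ≤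
      ENNReal.ofReal (2 * ((volume S).toReal + 2 * Real.pi)) := by
    have e : ∀ ζ, ENNReal.ofReal (I ζ) = ENNReal.ofReal (S.indicator (fun ζ => ‖ζ - z‖⁻¹) ζ) +
        ENNReal.ofReal (S.indicator (fun ζ => ‖ζ - w‖⁻¹) ζ) := by
      intro ζ
      rw [hI, indicator_add, ENNReal.ofReal_add] <;>
      exact indicator_nonneg (fun ζ _ => by positivity) ζ
    simp_rw [e]
    rw [lintegral_add_left]
    · refine (add_le_add (lintegral_indicator_inv_norm_le S hSm z)
        (lintegral_indicator_inv_norm_le S hSm w)).trans_eq ?_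
      rw [← two_mul, ENNReal.ofReal_mul (p := 2) (q := (volume S).toReal + 2 * Real.pi)
        (by norm_num), ENNReal.ofReal_add (by positivity)
        (by positivity), ENNReal.ofReal_toReal hSf]
      simp
    · exact (Measurable.indicator (by fun_prop) hSm).ennreal_ofReal
  have hb1 : ∀ᵐ ζ, ‖f ζ - c * (dbarTwo (osc σ z₀) ζ * G ζ)‖ₑ ≤
      ENNReal.ofReal (M * s ^ 2 * d⁻¹ * 6) * ENNReal.ofReal (H ζ) := by
    filter_upwards [hae] with ζ hζ
    rw [← ENNReal.ofReal_mul (by positivity), ← ofReal_norm]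
    refine ENNReal.ofReal_le_ofReal ((norm_remainder_le l₁ l₂ hs hσ (hM ζ) hd le_rfl hζ.1 hζ.2.1
      hζ.2.2).trans_eq ?_)
    rw [hH, cubicBump_sub_comm s z ζ]
    ring
  have hb2 : ∀ᵐ ζ, ‖osc σ z₀ ζ * dbarTwo G ζ‖ₑ ≤
      ENNReal.ofReal (M * d⁻¹ * 36) * ENNReal.ofReal (H ζ) +
      ENNReal.ofReal (2 * M' * d⁻¹ * s⁻¹) * ENNReal.ofReal (I ζ) := by
    filter_upwards [hae] with ζ hζ
    have hH0 : 0 ≤ H ζ := add_nonneg (add_nonneg (cubicBump_nonneg _ _) (cubicBump_nonneg _ _))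
        (cubicBump_nonneg _ _)
    have hIζ := hI0 ζ
    rw [← ENNReal.ofReal_mul (by positivity), ← ENNReal.ofReal_mul (by positivity),
      ← ENNReal.ofReal_add (by positivity) (by positivity), ← ofReal_norm, norm_mul,
      norm_osc, one_mul]
    refine ENNReal.ofReal_le_ofReal ((norm_dbarTwo_regAmplitude_le l₁ l₂ hχ hs (hM ζ) (hM' ζ) hd
      le_rfl hζ.1 hζ.2.1 hζ.2.2).trans_eq ?_)
    rw [hH, cubicBump_sub_comm s z ζ, hI]
    congr 1
    · ring
    · by_cases hmem : ζ ∈ S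
      · rw [indicator_of_mem hmem, indicator_of_mem hmem, norm_sub_rev z ζ]
      · rw [indicator_of_notMem hmem, indicator_of_notMem hmem, mul_zero]
  have hHm : Measurable fun ζ => ENNReal.ofReal (H ζ) := by rw [hH]; fun_prop
  have hT1 : ‖∫ ζ, (f ζ - c * (dbarTwo (osc σ z₀) ζ * G ζ))‖ₑ ≤
      ENNReal.ofReal (M * s ^ 2 * d⁻¹ * 6 * (12 * Real.pi * s⁻¹)) := by
    refine (enorm_integral_le_lintegral_enorm _).trans ((lintegral_mono_ae hb1).trans ?_)
    rw [lintegral_const_mul _ hHm,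
      ENNReal.ofReal_mul (p := M * s ^ 2 * d⁻¹ * 6) (by positivity)]
    gcongr
  have hT2 : ‖∫ ζ, osc σ z₀ ζ * dbarTwo G ζ‖ₑ ≤
      ENNReal.ofReal (M * d⁻¹ * 36 * (12 * Real.pi * s⁻¹) +
        2 * M' * d⁻¹ * s⁻¹ * (2 * ((volume S).toReal + 2 * Real.pi))) := by
    refine (enorm_integral_le_lintegral_enorm _).trans ((lintegral_mono_ae hb2).trans ?_)
    rw [lintegral_add_left (hHm.const_mul _), lintegral_const_mul _ hHm,
      lintegral_const_mul _ hImeas.ennreal_ofReal, ENNReal.ofReal_add (by positivity)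
      (by positivity), ENNReal.ofReal_mul (p := M * d⁻¹ * 36) (by positivity),
      ENNReal.ofReal_mul (p := 2 * M' * d⁻¹ * s⁻¹) (by positivity)]
    gcongr
  rw [hdecomp]
  refine enorm_sub_le.trans ?_
  rw [enorm_mul, ← ofReal_norm c, hcn]
  refine (add_le_add hT1 (mul_le_mul_right hT2 _)).trans ?_
  rw [← ENNReal.ofReal_mul (by positivity), ← ENNReal.ofReal_add (by positivity) (by positivity)]
  refine ENNReal.ofReal_le_ofReal (le_of_eq ?_)
  field_simp
  ring

end KernelBound

/-! ### Composition of two Cauchy operators -/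

theorem inv_mul_inv_le_rpow_of_le {a b d ε : ℝ} (ha : 0 < a) (hab : a ≤ b) (hd : 0 < d)
    (h : d ≤ a + b) (hε : 0 < ε) (hε1 : ε ≤ 1) :
    a⁻¹ * b⁻¹ ≤ 2 ^ ε * d ^ (-ε) * a ^ (ε - 2) := by
  have hb : 0 < b := ha.trans_le hab
  have h1 : b⁻¹ = b ^ (-ε) * b ^ (ε - 1) := by
    rw [← Real.rpow_add hb, ← Real.rpow_neg_one]; ring_nf
  have h2 : b ^ (-ε) ≤ (d / 2) ^ (-ε) :=
    Real.rpow_le_rpow_of_nonpos (by positivity) (by linarith) (by linarith)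
  have h3 : b ^ (ε - 1) ≤ a ^ (ε - 1) := Real.rpow_le_rpow_of_nonpos ha hab (by linarith)
  have h4 : (d / 2) ^ (-ε) = 2 ^ ε * d ^ (-ε) := by
    rw [Real.div_rpow hd.le (by norm_num), Real.rpow_neg (x := 2) (by norm_num), div_inv_eq_mul,
      mul_comm]
  have h5 : a ^ (ε - 2) = a⁻¹ * a ^ (ε - 1) := by
    rw [← Real.rpow_neg_one, ← Real.rpow_add ha]; ring_nf
  calc a⁻¹ * b⁻¹ ≤ a⁻¹ * ((d / 2) ^ (-ε) * a ^ (ε - 1)) := by rw [h1]; gcongr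
    _ = _ := by rw [h4, h5]; ring

theorem inv_mul_inv_le_rpow_add_rpow {a b d ε : ℝ} (ha : 0 < a) (hb : 0 < b) (hd : 0 < d)
    (h : d ≤ a + b) (hε : 0 < ε) (hε1 : ε ≤ 1) :
    a⁻¹ * b⁻¹ ≤ 2 ^ ε * d ^ (-ε) * (a ^ (ε - 2) + b ^ (ε - 2)) := by
  rcases le_total a b with hab | hab
  · refine (inv_mul_inv_le_rpow_of_le ha hab hd h hε hε1).trans ?_
    gcongr
    exact le_add_of_nonneg_right (by positivity)
  · rw [mul_comm a⁻¹]
    refine (inv_mul_inv_le_rpow_of_le hb hab hd (by linarith) hε hε1).trans ?_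
    gcongr
    exact le_add_of_nonneg_left (by positivity)

/-- Without using oscillation, the kernel of the composition has a singularity weaker than any
power. -/
theorem setLIntegral_inv_mul_inv_le {ε : ℝ} (hε : 0 < ε) (hε1 : ε ≤ 1) (S : Set ℂ)
    (hSf : volume S ≠ ⊤) {z w : ℂ} (hzw : z ≠ w) :
    ∫⁻ ζ in S, ENNReal.ofReal ‖z - ζ‖⁻¹ * ENNReal.ofReal ‖ζ - w‖⁻¹ ≤
      ENNReal.ofReal (2 ^ ε * (2 * ((volume S).toReal + 2 * Real.pi / ε)) * ‖z - w‖ ^ (-ε)) := by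
  have hd : 0 < ‖z - w‖ := norm_pos_iff.2 (sub_ne_zero.2 hzw)
  have hpi := Real.pi_pos
  have h : ∀ a : ℂ, ∀ᵐ ζ : ℂ ∂volume.restrict S, ζ ≠ a := fun a =>
    ae_restrict_of_ae (by simp [ae_iff])
  have hpt : ∀ᵐ ζ : ℂ ∂volume.restrict S,
      ENNReal.ofReal ‖z - ζ‖⁻¹ * ENNReal.ofReal ‖ζ - w‖⁻¹ ≤
      ENNReal.ofReal (2 ^ ε * ‖z - w‖ ^ (-ε)) * (ENNReal.ofReal (‖ζ - z‖ ^ (ε - 2)) +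
        ENNReal.ofReal (‖ζ - w‖ ^ (ε - 2))) := by
    filter_upwards [h z, h w] with ζ h1 h2
    rw [← ENNReal.ofReal_mul (by positivity), ← ENNReal.ofReal_add (by positivity) (by positivity),
      ← ENNReal.ofReal_mul (by positivity), norm_sub_rev z ζ]
    refine ENNReal.ofReal_le_ofReal (inv_mul_inv_le_rpow_add_rpow
      (norm_pos_iff.2 (sub_ne_zero.2 h1)) (norm_pos_iff.2 (sub_ne_zero.2 h2)) hd ?_ hε hε1)
    rw [norm_sub_rev ζ z]
    exact norm_sub_le_norm_sub_add_norm_sub z ζ w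
  have hb : ∀ a : ℂ, ∫⁻ ζ in S, ENNReal.ofReal (‖ζ - a‖ ^ (ε - 2)) ≤
      ENNReal.ofReal ((volume S).toReal + 2 * Real.pi / ε) := by
    intro a
    refine (setLIntegral_norm_sub_rpow_le (by linarith) (by linarith) S a).trans_eq ?_
    rw [ENNReal.ofReal_add (by positivity) (by positivity), ENNReal.ofReal_toReal hSf]
    congr 2
    rw [sub_add_cancel]; ring
  refine (lintegral_mono_ae hpt).trans ?_
  rw [lintegral_const_mul _ (by fun_prop), lintegral_add_left (by fun_prop)]
  calc _ ≤ ENNReal.ofReal (2 ^ ε * ‖z - w‖ ^ (-ε)) *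
        (ENNReal.ofReal ((volume S).toReal + 2 * Real.pi / ε) +
        ENNReal.ofReal ((volume S).toReal + 2 * Real.pi / ε)) := by gcongr <;> exact hb _
    _ = _ := by
      rw [← ENNReal.ofReal_add (by positivity) (by positivity),
        ← ENNReal.ofReal_mul (by positivity)]
      congr 1
      ring

/-- A weakly singular potential of a function supported in a set of finite measure is bounded. -/
theorem lintegral_norm_sub_rpow_mul_le {r r' γ : ℝ} (hr : r'.HolderConjugate r) (hγ : 0 ≤ γ)
    (hγr : γ * r' ≤ 1) {S : Set ℂ} (hS : MeasurableSet S) {u : ℂ → ℝ≥0∞} (hu : AEMeasurable u)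
    (hus : ∀ w, w ∉ S → u w = 0) (z : ℂ) :
    ∫⁻ w, ENNReal.ofReal (‖z - w‖ ^ (-γ)) * u w ≤
      (volume S + ENNReal.ofReal (2 * Real.pi)) ^ (1 / r') * (∫⁻ w, u w ^ r) ^ (1 / r) := by
  have hr0 := hr.pos
  have e : ∀ w, ENNReal.ofReal (‖z - w‖ ^ (-γ)) * u w =
      (S.indicator fun w => ENNReal.ofReal (‖z - w‖ ^ (-γ)) : ℂ → ℝ≥0∞) w * u w := by
    intro w
    by_cases hw : w ∈ S
    · rw [indicator_of_mem hw]
    · rw [hus w hw, mul_zero, mul_zero]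
  simp_rw [e]
  refine (ENNReal.lintegral_mul_le_Lp_mul_Lq volume hr
    (Measurable.indicator (f := fun w => ENNReal.ofReal (‖z - w‖ ^ (-γ))) (by fun_prop)
      hS).aemeasurable hu).trans ?_
  gcongr
  have e2 : ∀ w, (S.indicator fun w => ENNReal.ofReal (‖z - w‖ ^ (-γ)) : ℂ → ℝ≥0∞) w ^ r' =
      (S.indicator fun w => ENNReal.ofReal (‖w - z‖ ^ (-(γ * r'))) : ℂ → ℝ≥0∞) w := by
    intro w
    by_cases hw : w ∈ S
    · rw [indicator_of_mem hw, indicator_of_mem hw,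
        ENNReal.ofReal_rpow_of_nonneg (by positivity) hr0.le, ← Real.rpow_mul (norm_nonneg _),
        norm_sub_rev, neg_mul]
    · rw [indicator_of_notMem hw, indicator_of_notMem hw, ENNReal.zero_rpow_of_pos hr0]
  simp_rw [e2]
  rw [lintegral_indicator hS]
  have h0 : 0 ≤ γ * r' := by positivity
  refine (setLIntegral_norm_sub_rpow_le (by linarith) (by linarith) S z).trans ?_
  gcongr volume S + ENNReal.ofReal ?_
  have hpi := Real.pi_pos
  refine mul_le_of_le_one_right (by positivity) ?_
  rw [div_le_one (by linarith)]
  linarith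

theorem enorm_le_of_interpolation {K : ℂ} {a b d s ε : ℝ} (ha : 0 ≤ a) (hb : 0 ≤ b) (hd : 0 < d)
    (hs : 0 < s) (hε : 0 < ε) (hε1 : ε ≤ 1) (h1 : ‖K‖ₑ ≤ ENNReal.ofReal (s * d⁻¹ * a))
    (h2 : ‖K‖ₑ ≤ ENNReal.ofReal (b * d ^ (-ε))) :
    ‖K‖ₑ ≤ ENNReal.ofReal (a ^ ε * b ^ (1 - ε) * s ^ ε) *
      ENNReal.ofReal (d ^ (-(2 * ε - ε ^ 2))) := by
  rw [← ofReal_norm] at *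
  rw [ENNReal.ofReal_le_ofReal_iff (by positivity)] at h1 h2
  rw [← ENNReal.ofReal_mul (by positivity)]
  refine ENNReal.ofReal_le_ofReal ?_
  have e1 : ‖K‖ = ‖K‖ ^ ε * ‖K‖ ^ (1 - ε) := by
    rw [← Real.rpow_add_of_nonneg (norm_nonneg _) hε.le (by linarith), add_sub_cancel,
      Real.rpow_one]
  have e2 : (s * d⁻¹ * a) ^ ε * (b * d ^ (-ε)) ^ (1 - ε) =
      a ^ ε * b ^ (1 - ε) * s ^ ε * d ^ (-(2 * ε - ε ^ 2)) := by
    rw [Real.mul_rpow (by positivity) ha, Real.mul_rpow hs.le (by positivity),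
      Real.mul_rpow hb (by positivity), ← Real.rpow_neg_one d, ← Real.rpow_mul hd.le,
      ← Real.rpow_mul hd.le]
    have : d ^ (-(2 * ε - ε ^ 2)) = d ^ (-1 * ε) * d ^ (-ε * (1 - ε)) := by
      rw [← Real.rpow_add hd]; ring_nf
    rw [this]
    ring
  rw [e1, ← e2]
  have : 0 ≤ 1 - ε := by linarith
  gcongr

/-- The Cauchy operator with kernel `1 / (π l(z))`: `∂̄⁻¹` when `l` is the identity and `∂⁻¹` when
`l` is complex conjugation. -/
noncomputable def cauchyOp (l : ℂ ≃ₗᵢ[ℝ] ℂ) (u : ℂ → ℂ) (z : ℂ) : ℂ :=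
  ∫ w : ℂ, 1 / ((Real.pi : ℂ) * l (z - w)) * u w

theorem measurable_cauchyKernel (l : ℂ ≃ₗᵢ[ℝ] ℂ) :
    Measurable fun x : ℂ => 1 / ((Real.pi : ℂ) * l x) := by
  have := l.continuous.measurable
  fun_prop

theorem enorm_cauchyKernel_le (l : ℂ ≃ₗᵢ[ℝ] ℂ) (x : ℂ) :
    ‖1 / ((Real.pi : ℂ) * l x)‖ₑ ≤ ENNReal.ofReal ‖x‖⁻¹ := by
  rw [← ofReal_norm]
  refine ENNReal.ofReal_le_ofReal ?_
  rw [norm_div, norm_one, norm_mul, Complex.norm_real, LinearIsometryEquiv.norm_map, one_div,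
    mul_inv, Real.norm_of_nonneg Real.pi_pos.le]
  refine mul_le_of_le_one_left (by positivity) (inv_le_one_of_one_le₀ ?_)
  linarith [Real.pi_gt_three]

theorem enorm_cauchyOp_le (l : ℂ ≃ₗᵢ[ℝ] ℂ) (u : ℂ → ℂ) (z : ℂ) :
    ‖cauchyOp l u z‖ₑ ≤ rieszPotential (fun w => ‖u w‖ₑ) z := by
  refine (enorm_integral_le_lintegral_enorm _).trans (lintegral_mono fun w => ?_)
  rw [enorm_mul]
  gcongr
  exact enorm_cauchyKernel_le l _

theorem integrable_cauchyKernel_mul (l : ℂ ≃ₗᵢ[ℝ] ℂ) {u : ℂ → ℂ} (hu : AEStronglyMeasurable u)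
    {z : ℂ} (h : rieszPotential (fun w => ‖u w‖ₑ) z < ⊤) :
    Integrable fun w => 1 / ((Real.pi : ℂ) * l (z - w)) * u w := by
  refine ⟨((measurable_cauchyKernel l).comp (measurable_const.sub
    measurable_id)).aestronglyMeasurable.mul hu, lt_of_le_of_lt (lintegral_mono fun w => ?_) h⟩
  rw [enorm_mul]
  gcongr
  exact enorm_cauchyKernel_le l _

theorem aestronglyMeasurable_cauchyOp (l : ℂ ≃ₗᵢ[ℝ] ℂ) {u : ℂ → ℂ}
    (hu : AEStronglyMeasurable u) : AEStronglyMeasurable (cauchyOp l u) := by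
  refine AEStronglyMeasurable.integral_prod_right'
    (f := fun x : ℂ × ℂ => 1 / ((Real.pi : ℂ) * l (x.1 - x.2)) * u x.2) ?_
  exact ((measurable_cauchyKernel l).comp
    (measurable_fst.sub measurable_snd)).aestronglyMeasurable.mul hu.comp_snd

theorem ae_rieszPotential_lt_top {r q : ℝ} (hr₁ : 1 < r) (hr₂ : r < 2)
    (hrq : 1 / r = 1 / 2 + 1 / q) (hq : 0 < q) {u : ℂ → ℝ≥0∞} (hu : AEMeasurable u)
    (h : ∫⁻ w, u w ^ r < ⊤) : ∀ᵐ z, rieszPotential u z < ⊤ := by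
  obtain ⟨C, hC⟩ := hardyLittlewoodSobolev hr₁ hr₂ hrq hq
  have h1 : (∫⁻ z, rieszPotential u z ^ q) ^ (1 / q) < ⊤ :=
    (hC u hu).trans_lt (ENNReal.mul_lt_top (by simp)
      (ENNReal.rpow_lt_top_of_nonneg (by positivity) h.ne))
  have h2 : ∫⁻ z, rieszPotential u z ^ q ≠ ⊤ := fun h2 => by
    rw [h2, ENNReal.top_rpow_of_pos (by positivity)] at h1
    exact lt_irrefl _ h1
  have hm : Measurable (rieszPotential u) := by
    rw [rieszPotential_congr hu.ae_eq_mk]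
    exact measurable_rieszPotential hu.measurable_mk
  filter_upwards [ae_lt_top (by fun_prop) h2] with z hz
  by_contra hzt
  rw [not_lt, top_le_iff] at hzt
  rw [hzt, ENNReal.top_rpow_of_pos hq] at hz
  exact lt_irrefl _ hz

/-- The common form `-(1/4) l₁⁻¹ (φ l₂⁻¹ g)` of the two operators `S₁` and `S₂`. -/
noncomputable def twoCauchy (l₁ l₂ : ℂ ≃ₗᵢ[ℝ] ℂ) (φ g : ℂ → ℂ) (z : ℂ) : ℂ :=
  -(1 / 4) * cauchyOp l₁ (fun ζ => φ ζ * cauchyOp l₂ g ζ) z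

section TwoCauchy

variable {S : Set ℂ} {φ g : ℂ → ℂ} {M r : ℝ}

/-- The iterated integral defining the composition converges absolutely at every point. -/
theorem lintegral_twoCauchy_lt_top (hr₁ : 1 < r) (hS : MeasurableSet S) (hSf : volume S ≠ ⊤)
    (hφ : Measurable φ) (hφS : ∀ ζ, ζ ∉ S → φ ζ = 0) (hφM : ∀ ζ, ‖φ ζ‖ ≤ M)
    (hg : AEStronglyMeasurable g) (hgS : ∀ w, w ∉ S → g w = 0) (hgr : ∫⁻ w, ‖g w‖ₑ ^ r < ⊤)
    (z : ℂ) :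
    ∫⁻ ζ, ∫⁻ w, ENNReal.ofReal ‖z - ζ‖⁻¹ * ‖φ ζ‖ₑ * (ENNReal.ofReal ‖ζ - w‖⁻¹ * ‖g w‖ₑ) < ⊤ := by
  have hr0 : 0 < r := by linarith
  have hM0 : 0 ≤ M := (norm_nonneg _).trans (hφM 0)
  have hconj : (r / (r - 1)).HolderConjugate r := (Real.HolderConjugate.conjExponent hr₁).symm
  set r' := r / (r - 1) with hr'
  have hr'1 : 1 < r' := hconj.lt
  have hm : AEMeasurable (Function.uncurry fun ζ w : ℂ =>
      ENNReal.ofReal ‖z - ζ‖⁻¹ * ‖φ ζ‖ₑ * (ENNReal.ofReal ‖ζ - w‖⁻¹ * ‖g w‖ₑ))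
      (volume.prod volume) := by
    have h1 : AEMeasurable (fun x : ℂ × ℂ => ‖g x.2‖ₑ) (volume.prod volume) := hg.comp_snd.enorm
    have h2 : Measurable (fun x : ℂ × ℂ => ENNReal.ofReal ‖z - x.1‖⁻¹ * ‖φ x.1‖ₑ) := by fun_prop
    have h3 : Measurable (fun x : ℂ × ℂ => ENNReal.ofReal ‖x.1 - x.2‖⁻¹) := by fun_prop
    exact h2.aemeasurable.mul (h3.aemeasurable.mul h1)
  rw [lintegral_lintegral_swap hm]
  set ε : ℝ := r'⁻¹ with hε
  have hε0 : 0 < ε := by positivity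
  have hε1 : ε ≤ 1 := inv_le_one_of_one_le₀ hr'1.le
  set B : ℝ := 2 ^ ε * (2 * ((volume S).toReal + 2 * Real.pi / ε)) with hB
  have hpi := Real.pi_pos
  have hB0 : 0 ≤ B := by positivity
  have hne : ∀ᵐ w : ℂ, z ≠ w := by
    have : ∀ᵐ w : ℂ, w ≠ z := by simp [ae_iff]
    filter_upwards [this] with w hw using hw.symm
  have hb : ∀ᵐ w : ℂ, ∫⁻ ζ, ENNReal.ofReal ‖z - ζ‖⁻¹ * ‖φ ζ‖ₑ *
      (ENNReal.ofReal ‖ζ - w‖⁻¹ * ‖g w‖ₑ) ≤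
      ENNReal.ofReal (M * B) * (ENNReal.ofReal (‖z - w‖ ^ (-ε)) * ‖g w‖ₑ) := by
    filter_upwards [hne] with w hw
    calc _ ≤ ∫⁻ ζ, (S.indicator fun ζ => ENNReal.ofReal ‖z - ζ‖⁻¹ *
          ENNReal.ofReal ‖ζ - w‖⁻¹) ζ * (ENNReal.ofReal M * ‖g w‖ₑ) := by
          refine lintegral_mono fun ζ => ?_
          by_cases hζ : ζ ∈ S
          · have : ‖φ ζ‖ₑ ≤ ENNReal.ofReal M := by
              rw [← ofReal_norm]; exact ENNReal.ofReal_le_ofReal (hφM ζ)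
            rw [indicator_of_mem hζ]
            calc _ ≤ ENNReal.ofReal ‖z - ζ‖⁻¹ * ENNReal.ofReal M *
                  (ENNReal.ofReal ‖ζ - w‖⁻¹ * ‖g w‖ₑ) := by gcongr
              _ = _ := by ring
          · simp [hφS ζ hζ]
      _ = (∫⁻ ζ in S, ENNReal.ofReal ‖z - ζ‖⁻¹ * ENNReal.ofReal ‖ζ - w‖⁻¹) *
          (ENNReal.ofReal M * ‖g w‖ₑ) := by
          rw [lintegral_mul_const _ (Measurable.indicator (by fun_prop) hS),
            lintegral_indicator hS]
      _ ≤ ENNReal.ofReal (B * ‖z - w‖ ^ (-ε)) * (ENNReal.ofReal M * ‖g w‖ₑ) := by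
          gcongr
          exact setLIntegral_inv_mul_inv_le hε0 hε1 S hSf hw
      _ = _ := by
          rw [ENNReal.ofReal_mul hB0, ENNReal.ofReal_mul hM0]
          ring
  refine (lintegral_mono_ae hb).trans_lt ?_
  rw [lintegral_const_mul' _ _ ENNReal.ofReal_ne_top]
  refine ENNReal.mul_lt_top ENNReal.ofReal_lt_top ?_
  refine (lintegral_norm_sub_rpow_mul_le hconj hε0.le (by rw [hε, inv_mul_cancel₀ hconj.pos.ne'])
    hS hg.enorm (fun w hw => by simp [hgS w hw]) z).trans_lt ?_
  refine ENNReal.mul_lt_top (ENNReal.rpow_lt_top_of_nonneg (by positivity) ?_)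
    (ENNReal.rpow_lt_top_of_nonneg (by positivity) hgr.ne)
  exact ENNReal.add_ne_top.2 ⟨hSf, ENNReal.ofReal_ne_top⟩

theorem rieszPotential_cutoff_lt_top (l₂ : ℂ ≃ₗᵢ[ℝ] ℂ) (hr₁ : 1 < r) (hS : MeasurableSet S)
    (hSf : volume S ≠ ⊤) (hφ : Measurable φ) (hφS : ∀ ζ, ζ ∉ S → φ ζ = 0)
    (hφM : ∀ ζ, ‖φ ζ‖ ≤ M) (hg : AEStronglyMeasurable g) (hgS : ∀ w, w ∉ S → g w = 0)
    (hgr : ∫⁻ w, ‖g w‖ₑ ^ r < ⊤) (z : ℂ) :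
    rieszPotential (fun ζ => ‖φ ζ * cauchyOp l₂ g ζ‖ₑ) z < ⊤ := by
  refine lt_of_le_of_lt (lintegral_mono fun ζ => ?_)
    (lintegral_twoCauchy_lt_top hr₁ hS hSf hφ hφS hφM hg hgS hgr z)
  rw [lintegral_const_mul'' _ (by
    have h3 : Measurable (fun w : ℂ => ENNReal.ofReal ‖ζ - w‖⁻¹) := by fun_prop
    exact h3.aemeasurable.mul hg.enorm)]
  beta_reduce
  rw [enorm_mul, ← mul_assoc]
  gcongr
  exact enorm_cauchyOp_le l₂ g ζ

/-- By Fubini's theorem the composition is an integral operator with kernel `crossKernel`. -/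
theorem enorm_twoCauchy_le (l₁ l₂ : ℂ ≃ₗᵢ[ℝ] ℂ) (hr₁ : 1 < r) (hS : MeasurableSet S)
    (hSf : volume S ≠ ⊤) (hφ : Measurable φ) (hφS : ∀ ζ, ζ ∉ S → φ ζ = 0)
    (hφM : ∀ ζ, ‖φ ζ‖ ≤ M) (hg : AEStronglyMeasurable g) (hgS : ∀ w, w ∉ S → g w = 0)
    (hgr : ∫⁻ w, ‖g w‖ₑ ^ r < ⊤) (z : ℂ) :
    ‖twoCauchy l₁ l₂ φ g z‖ₑ ≤ ∫⁻ w, ‖crossKernel l₁ l₂ φ z w‖ₑ * ‖g w‖ₑ := by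
  set F : ℂ → ℂ → ℂ := fun ζ w => 1 / ((Real.pi : ℂ) * l₁ (z - ζ)) * φ ζ *
    (1 / ((Real.pi : ℂ) * l₂ (ζ - w)) * g w) with hF
  have hFi : Integrable (Function.uncurry F) (volume.prod volume) := by
    have hFm : AEStronglyMeasurable (Function.uncurry F) (volume.prod volume) := by
      have h1 : Measurable fun x : ℂ × ℂ => 1 / ((Real.pi : ℂ) * l₁ (z - x.1)) * φ x.1 :=
        ((measurable_cauchyKernel l₁).comp (measurable_const.sub measurable_fst)).mul
          (hφ.comp measurable_fst)
      have h2 : Measurable fun x : ℂ × ℂ => 1 / ((Real.pi : ℂ) * l₂ (x.1 - x.2)) :=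
        (measurable_cauchyKernel l₂).comp (measurable_fst.sub measurable_snd)
      exact h1.aestronglyMeasurable.mul (h2.aestronglyMeasurable.mul hg.comp_snd)
    refine ⟨hFm, ?_⟩
    rw [hasFiniteIntegral_iff_enorm, lintegral_prod _ hFm.enorm]
    refine lt_of_le_of_lt (lintegral_mono fun ζ => lintegral_mono fun w => ?_)
      (lintegral_twoCauchy_lt_top hr₁ hS hSf hφ hφS hφM hg hgS hgr z)
    simp only [Function.uncurry, hF, enorm_mul]
    gcongr <;> exact enorm_cauchyKernel_le _ _
  have h1 : cauchyOp l₁ (fun ζ => φ ζ * cauchyOp l₂ g ζ) z = ∫ ζ, ∫ w, F ζ w := by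
    unfold cauchyOp
    congr 1 with ζ
    rw [hF, integral_const_mul]
    ring
  have h2 : ∀ w, ∫ ζ, F ζ w = ((Real.pi : ℂ)⁻¹ ^ 2 * crossKernel l₁ l₂ φ z w) * g w := by
    intro w
    rw [crossKernel, ← integral_const_mul, ← integral_mul_const]
    congr 1 with ζ
    simp only [hF, one_div, mul_inv]
    ring
  have hpi : (1 : ℝ) ≤ Real.pi := by linarith [Real.pi_gt_three]
  rw [twoCauchy, h1, integral_integral_swap hFi]
  simp_rw [h2]
  rw [enorm_mul]
  have hq : ‖(-(1 / 4) : ℂ)‖ₑ ≤ 1 := by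
    rw [← ofReal_norm, ← ENNReal.ofReal_one]
    exact ENNReal.ofReal_le_ofReal (by norm_num)
  have hp : ‖(Real.pi : ℂ)⁻¹ ^ 2‖ₑ ≤ 1 := by
    rw [← ofReal_norm, ← ENNReal.ofReal_one]
    refine ENNReal.ofReal_le_ofReal ?_
    rw [norm_pow, norm_inv, Complex.norm_real, Real.norm_of_nonneg Real.pi_pos.le]
    exact pow_le_one₀ (by positivity) (inv_le_one_of_one_le₀ hpi)
  refine (mul_le_of_le_one_left' hq).trans ((enorm_integral_le_lintegral_enorm _).trans
    (lintegral_mono fun w => ?_))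
  rw [enorm_mul, enorm_mul]
  gcongr
  exact mul_le_of_le_one_left' hp

theorem enorm_crossKernel_le (l₁ l₂ : ℂ ≃ₗᵢ[ℝ] ℂ) {ε : ℝ} (hε : 0 < ε) (hε1 : ε ≤ 1)
    (hS : MeasurableSet S) (hSf : volume S ≠ ⊤) (hφS : ∀ ζ, ζ ∉ S → φ ζ = 0)
    (hφM : ∀ ζ, ‖φ ζ‖ ≤ M) {z w : ℂ} (hzw : z ≠ w) :
    ‖crossKernel l₁ l₂ φ z w‖ₑ ≤ ENNReal.ofReal
      (M * (2 ^ ε * (2 * ((volume S).toReal + 2 * Real.pi / ε))) * ‖z - w‖ ^ (-ε)) := by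
  have hM0 : 0 ≤ M := (norm_nonneg _).trans (hφM 0)
  have e : ∀ l : ℂ ≃ₗᵢ[ℝ] ℂ, ∀ x : ℂ, ‖(l x)⁻¹‖ₑ = ENNReal.ofReal ‖x‖⁻¹ := by
    intro l x
    rw [← ofReal_norm, norm_inv, LinearIsometryEquiv.norm_map]
  calc _ ≤ ∫⁻ ζ, ENNReal.ofReal M * (S.indicator fun ζ => ENNReal.ofReal ‖z - ζ‖⁻¹ *
          ENNReal.ofReal ‖ζ - w‖⁻¹) ζ := by
        refine (enorm_integral_le_lintegral_enorm _).trans (lintegral_mono fun ζ => ?_)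
        by_cases hζ : ζ ∈ S
        · have : ‖φ ζ‖ₑ ≤ ENNReal.ofReal M := by
            rw [← ofReal_norm]; exact ENNReal.ofReal_le_ofReal (hφM ζ)
          rw [indicator_of_mem hζ, enorm_mul, enorm_mul, e, e]
          calc _ ≤ ENNReal.ofReal ‖z - ζ‖⁻¹ * ENNReal.ofReal M * ENNReal.ofReal ‖ζ - w‖⁻¹ := by
                gcongr
            _ = _ := by ring
        · simp [hφS ζ hζ]
    _ = ENNReal.ofReal M * ∫⁻ ζ in S, ENNReal.ofReal ‖z - ζ‖⁻¹ * ENNReal.ofReal ‖ζ - w‖⁻¹ := by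
        rw [lintegral_const_mul _ (Measurable.indicator (by fun_prop) hS), lintegral_indicator hS]
    _ ≤ _ := by
        rw [mul_assoc, ENNReal.ofReal_mul hM0]
        gcongr
        exact setLIntegral_inv_mul_inv_le hε hε1 S hSf hzw

end TwoCauchy

/-! ### The operators between Lebesgue spaces -/

/-- The oscillating factor `exp (-iτ(Φ + Φ̄)) χ` between the two Cauchy operators. -/
noncomputable def oscWeight (χ : ℂ → ℂ) (τ : ℝ) (z₀ ζ : ℂ) : ℂ := osc (-τ) z₀ ζ * χ ζ

theorem norm_oscWeight (χ : ℂ → ℂ) (τ : ℝ) (z₀ ζ : ℂ) : ‖oscWeight χ τ z₀ ζ‖ = ‖χ ζ‖ := by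
  rw [oscWeight, norm_mul, norm_osc, one_mul]

theorem oscWeight_eq_zero {χ : ℂ → ℂ} (τ : ℝ) (z₀ : ℂ) {ζ : ℂ} (h : ζ ∉ tsupport χ) :
    oscWeight χ τ z₀ ζ = 0 := by
  rw [oscWeight, image_eq_zero_of_notMem_tsupport h, mul_zero]

theorem measurable_oscWeight {χ : ℂ → ℂ} (hχ : Continuous χ) (τ : ℝ) (z₀ : ℂ) :
    Measurable (oscWeight χ τ z₀) :=
  ((contDiff_osc (-τ) z₀).continuous.mul hχ).measurable

theorem exists_norm_le_and_norm_fderiv_le {χ : ℂ → ℂ} (hχ : ContDiff ℝ 1 χ)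
    (hχc : HasCompactSupport χ) : ∃ M : ℝ, (∀ ζ, ‖χ ζ‖ ≤ M) ∧ ∀ ζ, ‖fderiv ℝ χ ζ‖ ≤ M := by
  obtain ⟨M₁, h₁⟩ := hχc.exists_bound_of_continuous hχ.continuous
  obtain ⟨M₂, h₂⟩ := (hχc.fderiv ℝ).exists_bound_of_continuous (hχ.continuous_fderiv one_ne_zero)
  exact ⟨max M₁ M₂, fun ζ => (h₁ ζ).trans (le_max_left _ _),
    fun ζ => (h₂ ζ).trans (le_max_right _ _)⟩

theorem sq_rpow_neg_half {τ : ℝ} (hτ : 0 < τ) : |-τ| * (τ ^ (-(1 / 2) : ℝ)) ^ 2 = 1 := by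
  rw [abs_neg, abs_of_pos hτ, ← Real.rpow_natCast, ← Real.rpow_mul hτ.le]
  norm_num [Real.rpow_neg_one]
  exact mul_inv_cancel₀ hτ.ne'

/-- The kernel bound turns the composition into a Riesz potential with the gain `τ^(-1/2)`. -/
theorem exists_eLpNorm_twoCauchy_le {χ : ℂ → ℂ} (hχ : ContDiff ℝ 1 χ) (hχc : HasCompactSupport χ)
    {r q : ℝ} (hr₁ : 1 < r) (hr₂ : r < 2) (hrq : 1 / r = 1 / 2 + 1 / q) (hq : 0 < q) :
    ∃ C : ℝ, 0 ≤ C ∧ ∀ (l₁ l₂ : ℂ ≃ₗᵢ[ℝ] ℂ) (τ : ℝ) (z₀ : ℂ) (g : ℂ → ℂ), 0 < τ →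
      AEStronglyMeasurable g → (∀ w, w ∉ tsupport χ → g w = 0) → ∫⁻ w, ‖g w‖ₑ ^ r < ⊤ →
      (∫⁻ z, ‖twoCauchy l₁ l₂ (oscWeight χ τ z₀) g z‖ₑ ^ q) ^ (1 / q) ≤
        ENNReal.ofReal (C * τ ^ (-(1 / 2) : ℝ)) * (∫⁻ w, ‖g w‖ₑ ^ r) ^ (1 / r) := by
  obtain ⟨M, hM, hM'⟩ := exists_norm_le_and_norm_fderiv_le hχ hχc
  obtain ⟨C, hC⟩ := hardyLittlewoodSobolev hr₁ hr₂ hrq hq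
  have hM0 : 0 ≤ M := (norm_nonneg _).trans (hM 0)
  have hpi := Real.pi_pos
  set A : ℝ := 180 * Real.pi * M + M * ((volume (tsupport χ)).toReal + 2 * Real.pi) with hA
  have hA0 : 0 ≤ A := by positivity
  refine ⟨A * C, by positivity, fun l₁ l₂ τ z₀ g hτ hg hgS hgr => ?_⟩
  set s := τ ^ (-(1 / 2) : ℝ) with hs
  have hs0 : 0 < s := by positivity
  have hpt : ∀ z, ‖twoCauchy l₁ l₂ (oscWeight χ τ z₀) g z‖ₑ ≤
      ENNReal.ofReal (s * A) * rieszPotential (fun w => ‖g w‖ₑ) z := by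
    intro z
    refine (enorm_twoCauchy_le l₁ l₂ hr₁ (isClosed_tsupport χ).measurableSet
      hχc.measure_lt_top.ne (measurable_oscWeight hχ.continuous τ z₀)
      (fun ζ hζ => oscWeight_eq_zero τ z₀ hζ) (M := M)
      (fun ζ => (norm_oscWeight χ τ z₀ ζ).trans_le (hM ζ)) hg hgS hgr z).trans ?_
    rw [rieszPotential, ← lintegral_const_mul' _ _ ENNReal.ofReal_ne_top]
    have hne : ∀ᵐ w : ℂ, w ≠ z := by simp [ae_iff]
    refine lintegral_mono_ae ?_
    filter_upwards [hne] with w hw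
    rw [← mul_assoc, ← ENNReal.ofReal_mul (by positivity)]
    gcongr
    refine (enorm_crossKernel_osc_le l₁ l₂ hχ hχc hM hM' hs0 (sq_rpow_neg_half hτ)
      hw.symm).trans_eq ?_
    congr 1
    ring
  calc _ ≤ (∫⁻ z, (ENNReal.ofReal (s * A) * rieszPotential (fun w => ‖g w‖ₑ) z) ^ q) ^ (1 / q) := by
        gcongr with z
        exact hpt z
    _ = ENNReal.ofReal (s * A) *
        (∫⁻ z, rieszPotential (fun w => ‖g w‖ₑ) z ^ q) ^ (1 / q) := by
        simp_rw [ENNReal.mul_rpow_of_nonneg _ _ hq.le]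
        rw [lintegral_const_mul' _ _ (ENNReal.rpow_ne_top_of_nonneg hq.le ENNReal.ofReal_ne_top),
          ENNReal.mul_rpow_of_nonneg _ _ (by positivity), ← ENNReal.rpow_mul,
          mul_one_div_cancel hq.ne', ENNReal.rpow_one]
    _ ≤ ENNReal.ofReal (s * A) * (C * (∫⁻ w, ‖g w‖ₑ ^ r) ^ (1 / r)) := by
        gcongr
        exact hC _ hg.enorm
    _ = _ := by
        rw [← mul_assoc, ← ENNReal.ofReal_coe_nnreal, ← ENNReal.ofReal_mul (by positivity)]
        congr 2
        ring

/-- Interpolating between the oscillatory and the trivial kernel bound gives a uniform bound with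
a small power of `τ`. -/
theorem exists_enorm_twoCauchy_le {χ : ℂ → ℂ} (hχ : ContDiff ℝ 1 χ) (hχc : HasCompactSupport χ)
    {r : ℝ} (hr₁ : 1 < r) :
    ∃ C : ℝ, 0 ≤ C ∧ ∀ (l₁ l₂ : ℂ ≃ₗᵢ[ℝ] ℂ) (τ : ℝ) (z₀ : ℂ) (g : ℂ → ℂ), 0 < τ →
      AEStronglyMeasurable g → (∀ w, w ∉ tsupport χ → g w = 0) → ∫⁻ w, ‖g w‖ₑ ^ r < ⊤ →
      ∀ z, ‖twoCauchy l₁ l₂ (oscWeight χ τ z₀) g z‖ₑ ≤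
        ENNReal.ofReal (C * τ ^ (-((1 - 1 / r) / 4))) * (∫⁻ w, ‖g w‖ₑ ^ r) ^ (1 / r) := by
  obtain ⟨M, hM, hM'⟩ := exists_norm_le_and_norm_fderiv_le hχ hχc
  have hM0 : 0 ≤ M := (norm_nonneg _).trans (hM 0)
  have hpi := Real.pi_pos
  have hSm := (isClosed_tsupport χ).measurableSet
  have hSf : volume (tsupport χ) ≠ ⊤ := hχc.measure_lt_top.ne
  set A : ℝ := 180 * Real.pi * M + M * ((volume (tsupport χ)).toReal + 2 * Real.pi) with hA
  have hA0 : 0 ≤ A := by positivity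
  have hconj : (r / (r - 1)).HolderConjugate r := (Real.HolderConjugate.conjExponent hr₁).symm
  set r' := r / (r - 1) with hr'
  have hr'1 : 1 < r' := hconj.lt
  have hr'0 : 0 < r' := hconj.pos
  -- the exponent of interpolation, so small that the kernel stays in `L^{r'}`
  set ε : ℝ := 1 / (2 * r') with hε
  have hε0 : 0 < ε := by positivity
  have hε1 : ε ≤ 1 := by
    rw [hε, div_le_one (by positivity)]; linarith
  set B : ℝ := M * (2 ^ ε * (2 * ((volume (tsupport χ)).toReal + 2 * Real.pi / ε))) with hB
  have hB0 : 0 ≤ B := by positivity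
  set V : ℝ≥0∞ := (volume (tsupport χ) + ENNReal.ofReal (2 * Real.pi)) ^ (1 / r') with hV
  have hVt : V ≠ ⊤ := ENNReal.rpow_ne_top_of_nonneg (by positivity)
    (ENNReal.add_ne_top.2 ⟨hSf, ENNReal.ofReal_ne_top⟩)
  refine ⟨A ^ ε * B ^ (1 - ε) * V.toReal, by positivity, fun l₁ l₂ τ z₀ g hτ hg hgS hgr z => ?_⟩
  set s := τ ^ (-(1 / 2) : ℝ) with hs
  have hs0 : 0 < s := by positivity
  have hφM : ∀ ζ, ‖oscWeight χ τ z₀ ζ‖ ≤ M :=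
    fun ζ => (norm_oscWeight χ τ z₀ ζ).trans_le (hM ζ)
  have hsε : s ^ ε = τ ^ (-((1 - 1 / r) / 4)) := by
    rw [hs, ← Real.rpow_mul hτ.le]
    congr 1
    rw [hε, hr']
    have : r - 1 ≠ 0 := by linarith
    field_simp
    ring
  have hne : ∀ᵐ w : ℂ, w ≠ z := by simp [ae_iff]
  have hb : ∀ᵐ w : ℂ, ‖crossKernel l₁ l₂ (oscWeight χ τ z₀) z w‖ₑ * ‖g w‖ₑ ≤
      ENNReal.ofReal (A ^ ε * B ^ (1 - ε) * s ^ ε) *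
        (ENNReal.ofReal (‖z - w‖ ^ (-(2 * ε - ε ^ 2))) * ‖g w‖ₑ) := by
    filter_upwards [hne] with w hw
    rw [← mul_assoc]
    gcongr
    exact enorm_le_of_interpolation hA0 hB0 (norm_pos_iff.2 (sub_ne_zero.2 hw.symm)) hs0 hε0 hε1
      (enorm_crossKernel_osc_le l₁ l₂ hχ hχc hM hM' hs0 (sq_rpow_neg_half hτ) hw.symm)
      (enorm_crossKernel_le l₁ l₂ hε0 hε1 hSm hSf (fun ζ hζ => oscWeight_eq_zero τ z₀ hζ) hφM
        hw.symm)
  have hγ : 0 ≤ 2 * ε - ε ^ 2 := by nlinarith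
  have hγr : (2 * ε - ε ^ 2) * r' ≤ 1 := by
    have : 2 * ε * r' = 1 := by rw [hε]; field_simp
    nlinarith [mul_nonneg (sq_nonneg ε) hr'0.le]
  refine (enorm_twoCauchy_le l₁ l₂ hr₁ hSm hSf (measurable_oscWeight hχ.continuous τ z₀)
    (fun ζ hζ => oscWeight_eq_zero τ z₀ hζ) hφM hg hgS hgr z).trans
    ((lintegral_mono_ae hb).trans ?_)
  rw [lintegral_const_mul' _ _ ENNReal.ofReal_ne_top]
  calc _ ≤ ENNReal.ofReal (A ^ ε * B ^ (1 - ε) * s ^ ε) *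
        (V * (∫⁻ w, ‖g w‖ₑ ^ r) ^ (1 / r)) := by
        gcongr
        exact lintegral_norm_sub_rpow_mul_le hconj hγ hγr hSm hg.enorm
          (fun w hw => by simp [hgS w hw]) z
    _ = _ := by
        rw [← hsε, ← mul_assoc]
        conv_lhs => rw [← ENNReal.ofReal_toReal hVt]
        rw [← ENNReal.ofReal_mul (by positivity)]
        congr 2
        ring

/-- Both integrals in the formula `twoCauchy l₁ l₂ φ g` converge absolutely almost everywhere. -/
def TwoCauchyConverges (l₂ : ℂ ≃ₗᵢ[ℝ] ℂ) (φ g : ℂ → ℂ) : Prop :=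
  CauchyConverges g ∧ CauchyConverges (fun ζ => φ ζ * cauchyOp l₂ g ζ)

theorem cauchyConverges_of_rieszPotential {u : ℂ → ℂ} (hu : AEStronglyMeasurable u)
    (h : ∀ᵐ z, rieszPotential (fun w => ‖u w‖ₑ) z < ⊤) : CauchyConverges u := by
  filter_upwards [h] with z hz
  exact ⟨integrable_cauchyKernel_mul (LinearIsometryEquiv.refl ℝ ℂ) hu hz,
    integrable_cauchyKernel_mul Complex.conjLIE hu hz⟩

/-- A formula respecting equality almost everywhere on `X`, additive and homogeneous, and satisfying
a norm inequality defines a bounded linear map between spaces of classes. -/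
theorem mapsBoundedly_of_eLpNorm_le {X : Set ℂ} {t o : ℝ≥0∞} {conv : (ℂ → ℂ) → Prop}
    {A : (ℂ → ℂ) → ℂ → ℂ} {K : ℝ} (hK : 0 ≤ K)
    (hconv : ∀ f, MemLp f t (volume.restrict X) → conv f)
    (hmeas : ∀ f, MemLp f t (volume.restrict X) → AEStronglyMeasurable (A f) (volume.restrict X))
    (hbound : ∀ f, MemLp f t (volume.restrict X) → eLpNorm (A f) o (volume.restrict X) ≤
      ENNReal.ofReal K * eLpNorm f t (volume.restrict X))
    (hcongr : ∀ f g, f =ᵐ[volume.restrict X] g → A f = A g)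
    (hadd : ∀ f g, MemLp f t (volume.restrict X) → MemLp g t (volume.restrict X) →
      A (f + g) = A f + A g)
    (hsmul : ∀ (c : ℂ) (f : ℂ → ℂ), A (c • f) = c • A f) :
    MapsBoundedly X t o conv A K := by
  have hmem : ∀ f : Lp ℂ t (volume.restrict X), MemLp (A f) o (volume.restrict X) := fun f =>
    ⟨hmeas f (Lp.memLp f), (hbound f (Lp.memLp f)).trans_lt
      (ENNReal.mul_lt_top ENNReal.ofReal_lt_top (Lp.memLp f).2)⟩
  refine ⟨{ toFun := fun f => (hmem f).toLp, map_add' := ?_, map_smul' := ?_ }, ?_, ?_⟩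
  · intro f g
    rw [← MemLp.toLp_add]
    refine MemLp.toLp_congr _ _ (Filter.Eventually.of_forall fun z => ?_)
    rw [hcongr _ _ (Lp.coeFn_add f g), hadd _ _ (Lp.memLp f) (Lp.memLp g)]
  · intro c f
    rw [RingHom.id_apply, ← MemLp.toLp_const_smul]
    refine MemLp.toLp_congr _ _ (Filter.Eventually.of_forall fun z => ?_)
    rw [hcongr _ _ (Lp.coeFn_smul c f), hsmul]
  · exact fun f => ⟨hconv f (Lp.memLp f), (hmem f).coeFn_toLp⟩
  · intro f
    change ‖(hmem f).toLp‖ ≤ K * ‖f‖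
    rw [Lp.norm_toLp, Lp.norm_def, ← ENNReal.toReal_ofReal hK, ← ENNReal.toReal_mul]
    exact ENNReal.toReal_mono (ENNReal.mul_ne_top ENNReal.ofReal_ne_top (Lp.memLp f).2.ne)
      (hbound f (Lp.memLp f))

theorem oscPotential_eq_indicator (Ω : Set ℂ) (q : ℂ → ℂ) (τ : ℝ) (z₀ : ℂ) (f : ℂ → ℂ) :
    oscPotential Ω q τ z₀ f = Ω.indicator fun z => osc τ z₀ z * (q z * f z) := by
  funext z
  by_cases hz : z ∈ Ω <;> simp [oscPotential, hz]

theorem aestronglyMeasurable_oscPotential {Ω X : Set ℂ} (hΩ : MeasurableSet Ω) (hΩX : Ω ⊆ X)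
    {q f : ℂ → ℂ} (hq : AEStronglyMeasurable q (volume.restrict Ω))
    (hf : AEStronglyMeasurable f (volume.restrict X)) (τ : ℝ) (z₀ : ℂ) :
    AEStronglyMeasurable (oscPotential Ω q τ z₀ f) := by
  rw [oscPotential_eq_indicator, aestronglyMeasurable_indicator_iff hΩ]
  exact (contDiff_osc τ z₀).continuous.aestronglyMeasurable.mul
    (hq.mul (hf.mono_measure (Measure.restrict_mono hΩX le_rfl)))

theorem eLpNorm_oscPotential_le {Ω X : Set ℂ} (hΩ : MeasurableSet Ω) (hΩX : Ω ⊆ X)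
    {p t r : ℝ≥0∞} [ENNReal.HolderTriple p t r]
    {q f : ℂ → ℂ} (hq : AEStronglyMeasurable q (volume.restrict Ω))
    (hf : AEStronglyMeasurable f (volume.restrict X)) (τ : ℝ) (z₀ : ℂ) :
    eLpNorm (oscPotential Ω q τ z₀ f) r volume ≤
      eLpNorm q p (volume.restrict Ω) * eLpNorm f t (volume.restrict X) := by
  rw [oscPotential_eq_indicator, eLpNorm_indicator_eq_eLpNorm_restrict hΩ]
  have hle : volume.restrict Ω ≤ volume.restrict X := Measure.restrict_mono hΩX le_rfl
  calc _ = eLpNorm (q • f) r (volume.restrict Ω) := by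
        refine eLpNorm_congr_norm_ae (Filter.Eventually.of_forall fun z => ?_)
        rw [norm_mul, norm_osc, one_mul, Pi.smul_apply', smul_eq_mul]
    _ ≤ eLpNorm q p (volume.restrict Ω) * eLpNorm f t (volume.restrict Ω) :=
        eLpNorm_smul_le_mul_eLpNorm (hf.mono_measure hle) hq
    _ ≤ _ := by
        gcongr

theorem cauchyOp_congr (l : ℂ ≃ₗᵢ[ℝ] ℂ) {u v : ℂ → ℂ} (h : u =ᵐ[volume] v) :
    cauchyOp l u = cauchyOp l v := by
  funext z
  refine integral_congr_ae ?_
  filter_upwards [h] with w hw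
  rw [hw]

theorem cauchyOp_const_mul (l : ℂ ≃ₗᵢ[ℝ] ℂ) (c : ℂ) (u : ℂ → ℂ) (z : ℂ) :
    cauchyOp l (fun w => c * u w) z = c * cauchyOp l u z := by
  unfold cauchyOp
  rw [← integral_const_mul]
  congr 1 with w
  ring

theorem cauchyOp_add (l : ℂ ≃ₗᵢ[ℝ] ℂ) {u v : ℂ → ℂ} {z : ℂ} (hu : AEStronglyMeasurable u)
    (hv : AEStronglyMeasurable v) (hu' : rieszPotential (fun w => ‖u w‖ₑ) z < ⊤)
    (hv' : rieszPotential (fun w => ‖v w‖ₑ) z < ⊤) :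
    cauchyOp l (fun w => u w + v w) z = cauchyOp l u z + cauchyOp l v z := by
  unfold cauchyOp
  rw [← integral_add (integrable_cauchyKernel_mul l hu hu') (integrable_cauchyKernel_mul l hv hv')]
  congr 1 with w
  ring

theorem twoCauchy_const_mul (l₁ l₂ : ℂ ≃ₗᵢ[ℝ] ℂ) (φ : ℂ → ℂ) (c : ℂ) (g : ℂ → ℂ) (z : ℂ) :
    twoCauchy l₁ l₂ φ (fun w => c * g w) z = c * twoCauchy l₁ l₂ φ g z := by
  unfold twoCauchy
  simp_rw [cauchyOp_const_mul, mul_left_comm (φ _) c]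
  rw [cauchyOp_const_mul]
  ring

section Operator

variable {Ω X : Set ℂ} {χ q : ℂ → ℂ} {p r : ℝ} {t : ℝ≥0∞}

/-- What is used about the source `g = exp (iτ(Φ + Φ̄)) q f` of the operators: it is an `L^r`
function living on the support of the cutoff. -/
structure IsSource (χ : ℂ → ℂ) (r : ℝ) (g : ℂ → ℂ) : Prop where
  meas : AEStronglyMeasurable g
  eq_zero : ∀ w, w ∉ tsupport χ → g w = 0
  lt_top : ∫⁻ w, ‖g w‖ₑ ^ r < ⊤

theorem UsualAssumptions.contDiff_one (h : UsualAssumptions Ω X χ) : ContDiff ℝ 1 χ :=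
  h.smooth.of_le (by exact_mod_cast le_top)

theorem UsualAssumptions.subset (h : UsualAssumptions Ω X χ) : Ω ⊆ X :=
  subset_closure.trans h.closure_subset

theorem UsualAssumptions.subset_tsupport (h : UsualAssumptions Ω X χ) : Ω ⊆ tsupport χ :=
  fun z hz => _root_.subset_tsupport χ (by simp [h.eq_one z hz])

theorem lintegral_rpow_rpow_eq_eLpNorm (hr : 0 < r) (g : ℂ → ℂ) :
    (∫⁻ w, ‖g w‖ₑ ^ r) ^ (1 / r) = eLpNorm g (ENNReal.ofReal r) volume := by
  rw [eLpNorm_eq_lintegral_rpow_enorm_toReal (by simpa using hr) ENNReal.ofReal_ne_top,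
    ENNReal.toReal_ofReal hr.le]

theorem isSource_oscPotential (h : UsualAssumptions Ω X χ) (hr : 0 < r)
    [ENNReal.HolderTriple (ENNReal.ofReal p) t (ENNReal.ofReal r)]
    (hq : MemLp q (ENNReal.ofReal p) (volume.restrict Ω)) {f : ℂ → ℂ}
    (hf : MemLp f t (volume.restrict X)) (τ : ℝ) (z₀ : ℂ) :
    IsSource χ r (oscPotential Ω q τ z₀ f) := by
  refine ⟨aestronglyMeasurable_oscPotential h.isOpen_Ω.measurableSet h.subset hq.1 hf.1 τ z₀,
    fun w hw => ?_, ?_⟩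
  · rw [oscPotential_eq_indicator, indicator_of_notMem fun hw' => hw (h.subset_tsupport hw')]
  · have h1 : eLpNorm (oscPotential Ω q τ z₀ f) (ENNReal.ofReal r) volume < ⊤ :=
      (eLpNorm_oscPotential_le (p := ENNReal.ofReal p) (t := t) h.isOpen_Ω.measurableSet h.subset
        hq.1 hf.1 τ z₀).trans_lt (ENNReal.mul_lt_top hq.2 hf.2)
    rw [← lintegral_rpow_rpow_eq_eLpNorm hr] at h1
    by_contra h2
    rw [not_lt, top_le_iff] at h2
    rw [h2, ENNReal.top_rpow_of_pos (by positivity)] at h1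
    exact lt_irrefl _ h1

theorem IsSource.rieszPotential_cutoff_lt_top {g : ℂ → ℂ} (hg : IsSource χ r g) (hr₁ : 1 < r)
    (h : UsualAssumptions Ω X χ) (l₂ : ℂ ≃ₗᵢ[ℝ] ℂ) (τ : ℝ) (z₀ z : ℂ) :
    rieszPotential (fun ζ => ‖oscWeight χ τ z₀ ζ * cauchyOp l₂ g ζ‖ₑ) z < ⊤ := by
  obtain ⟨M, hM, -⟩ := exists_norm_le_and_norm_fderiv_le h.contDiff_one h.compactSupport
  exact _root_.rieszPotential_cutoff_lt_top l₂ hr₁ (isClosed_tsupport χ).measurableSet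
    h.compactSupport.measure_lt_top.ne (measurable_oscWeight h.smooth.continuous τ z₀)
    (fun ζ hζ => oscWeight_eq_zero τ z₀ hζ)
    (fun ζ => (norm_oscWeight χ τ z₀ ζ).trans_le (hM ζ)) hg.meas hg.eq_zero hg.lt_top z

theorem aestronglyMeasurable_cutoff (h : UsualAssumptions Ω X χ) (l₂ : ℂ ≃ₗᵢ[ℝ] ℂ) (τ : ℝ)
    (z₀ : ℂ) {g : ℂ → ℂ} (hg : AEStronglyMeasurable g) :
    AEStronglyMeasurable fun ζ => oscWeight χ τ z₀ ζ * cauchyOp l₂ g ζ :=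
  (measurable_oscWeight h.smooth.continuous τ z₀).aestronglyMeasurable.mul
    (aestronglyMeasurable_cauchyOp l₂ hg)

/-- The operator `f ↦ twoCauchy l₁ l₂ φ (exp (iτ(Φ + Φ̄)) q f)` is a bounded linear map as soon as
the corresponding norm inequality holds for sources in `L^r`, `1/r = 1/p + 1/t`. -/
theorem mapsBoundedly_twoCauchy (h : UsualAssumptions Ω X χ) (hr₁ : 1 < r) (hr₂ : r < 2)
    [ENNReal.HolderTriple (ENNReal.ofReal p) t (ENNReal.ofReal r)]
    (hq : MemLp q (ENNReal.ofReal p) (volume.restrict Ω)) (l₁ l₂ : ℂ ≃ₗᵢ[ℝ] ℂ) (τ : ℝ) (z₀ : ℂ)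
    {o : ℝ≥0∞} {C : ℝ} (hC : 0 ≤ C)
    (hb : ∀ g, IsSource χ r g → eLpNorm (twoCauchy l₁ l₂ (oscWeight χ τ z₀) g) o volume ≤
      ENNReal.ofReal C * eLpNorm g (ENNReal.ofReal r) volume)
    {K : ℝ} (hK : C * potentialNorm p Ω q ≤ K) :
    MapsBoundedly X t o
      (fun f => TwoCauchyConverges l₂ (oscWeight χ τ z₀) (oscPotential Ω q τ z₀ f))
      (fun f => twoCauchy l₁ l₂ (oscWeight χ τ z₀) (oscPotential Ω q τ z₀ f)) K := by
  have hr0 : 0 < r := by linarith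
  have hsrc : ∀ f, MemLp f t (volume.restrict X) → IsSource χ r (oscPotential Ω q τ z₀ f) :=
    fun f hf => isSource_oscPotential h hr0 hq hf τ z₀
  have hae : ∀ g, IsSource χ r g → ∀ᵐ z, rieszPotential (fun w => ‖g w‖ₑ) z < ⊤ := by
    intro g hg
    have h1 : 1 / 2 < 1 / r := one_div_lt_one_div_of_lt hr0 hr₂
    refine ae_rieszPotential_lt_top (q := 1 / (1 / r - 1 / 2)) hr₁ hr₂ ?_ ?_ hg.meas.enorm hg.lt_top
    · rw [one_div_one_div]; ring
    · exact one_div_pos.2 (by linarith)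
  have hP : 0 ≤ potentialNorm p Ω q := ENNReal.toReal_nonneg
  refine mapsBoundedly_of_eLpNorm_le ((mul_nonneg hC hP).trans hK) ?_ ?_ ?_ ?_ ?_ ?_
  · intro f hf
    have hg := hsrc f hf
    refine ⟨cauchyConverges_of_rieszPotential hg.meas (hae _ hg),
      cauchyConverges_of_rieszPotential (aestronglyMeasurable_cutoff h l₂ τ z₀ hg.meas)
        (Filter.Eventually.of_forall fun z => ?_)⟩
    exact hg.rieszPotential_cutoff_lt_top hr₁ h l₂ τ z₀ z
  · intro f hf
    have := (aestronglyMeasurable_cauchyOp l₁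
      (aestronglyMeasurable_cutoff h l₂ τ z₀ (hsrc f hf).meas)).const_mul (-(1 / 4))
    exact this.restrict
  · intro f hf
    refine (eLpNorm_mono_measure _ Measure.restrict_le_self).trans ((hb _ (hsrc f hf)).trans ?_)
    refine (mul_le_mul_right (eLpNorm_oscPotential_le (p := ENNReal.ofReal p) (t := t)
      h.isOpen_Ω.measurableSet h.subset hq.1 hf.1 τ z₀) _).trans ?_
    rw [← mul_assoc]
    gcongr
    rw [← ENNReal.ofReal_toReal hq.2.ne, ← ENNReal.ofReal_mul hC]
    exact ENNReal.ofReal_le_ofReal hK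
  · intro f f' hff'
    have : oscPotential Ω q τ z₀ f =ᵐ[volume] oscPotential Ω q τ z₀ f' := by
      rw [oscPotential_eq_indicator, oscPotential_eq_indicator]
      have h1 := (ae_restrict_iff' h.isOpen_Ω.measurableSet).1
        (ae_restrict_of_ae_restrict_of_subset h.subset hff')
      filter_upwards [h1] with z hz
      by_cases hzΩ : z ∈ Ω
      · rw [indicator_of_mem hzΩ, indicator_of_mem hzΩ, hz hzΩ]
      · rw [indicator_of_notMem hzΩ, indicator_of_notMem hzΩ]
    funext z
    simp only [twoCauchy]
    rw [cauchyOp_congr l₂ this]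
  · intro f f' hf hf'
    have hg := hsrc f hf
    have hg' := hsrc f' hf'
    have e : oscPotential Ω q τ z₀ (f + f') =
        fun w => oscPotential Ω q τ z₀ f w + oscPotential Ω q τ z₀ f' w := by
      funext w
      simp only [oscPotential, Pi.add_apply]
      ring
    have e2 : (fun ζ => oscWeight χ τ z₀ ζ * cauchyOp l₂ (oscPotential Ω q τ z₀ (f + f')) ζ)
        =ᵐ[volume] fun ζ => oscWeight χ τ z₀ ζ * cauchyOp l₂ (oscPotential Ω q τ z₀ f) ζ +
          oscWeight χ τ z₀ ζ * cauchyOp l₂ (oscPotential Ω q τ z₀ f') ζ := by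
      filter_upwards [hae _ hg, hae _ hg'] with ζ h1 h2
      rw [e, cauchyOp_add l₂ hg.meas hg'.meas h1 h2, mul_add]
    funext z
    simp only [twoCauchy, Pi.add_apply]
    rw [cauchyOp_congr l₁ e2, cauchyOp_add l₁ (aestronglyMeasurable_cutoff h l₂ τ z₀ hg.meas)
      (aestronglyMeasurable_cutoff h l₂ τ z₀ hg'.meas)
      (hg.rieszPotential_cutoff_lt_top hr₁ h l₂ τ z₀ z)
      (hg'.rieszPotential_cutoff_lt_top hr₁ h l₂ τ z₀ z), mul_add]
  · intro c f
    have e : oscPotential Ω q τ z₀ (c • f) = fun w => c * oscPotential Ω q τ z₀ f w := by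
      funext w
      simp only [oscPotential, Pi.smul_apply, smul_eq_mul]
      ring
    funext z
    rw [e, twoCauchy_const_mul]
    rfl

theorem oscCutoff_eq (χ : ℂ → ℂ) (τ : ℝ) (z₀ : ℂ) (u : ℂ → ℂ) :
    oscCutoff χ τ z₀ u = fun ζ => oscWeight χ τ z₀ ζ * u ζ := by
  funext ζ
  rw [oscCutoff, oscWeight, mul_assoc]

theorem opS₁_eq_twoCauchy (Ω : Set ℂ) (χ q : ℂ → ℂ) (τ : ℝ) (z₀ : ℂ) :
    opS₁ Ω χ q τ z₀ = fun f => twoCauchy (LinearIsometryEquiv.refl ℝ ℂ) Complex.conjLIE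
      (oscWeight χ τ z₀) (oscPotential Ω q τ z₀ f) := by
  funext f z
  rw [opS₁, oscCutoff_eq]
  rfl

theorem opS₂_eq_twoCauchy (Ω : Set ℂ) (χ q : ℂ → ℂ) (τ : ℝ) (z₀ : ℂ) :
    opS₂ Ω χ q τ z₀ = fun f => twoCauchy Complex.conjLIE (LinearIsometryEquiv.refl ℝ ℂ)
      (oscWeight χ τ z₀) (oscPotential Ω q τ z₀ f) := by
  funext f z
  rw [opS₂, oscCutoff_eq]
  rfl

theorem S₁Converges_eq (Ω : Set ℂ) (χ q : ℂ → ℂ) (τ : ℝ) (z₀ : ℂ) :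
    S₁Converges Ω χ q τ z₀ = fun f => TwoCauchyConverges Complex.conjLIE
      (oscWeight χ τ z₀) (oscPotential Ω q τ z₀ f) := by
  funext f
  rw [S₁Converges, oscCutoff_eq]
  rfl

theorem S₂Converges_eq (Ω : Set ℂ) (χ q : ℂ → ℂ) (τ : ℝ) (z₀ : ℂ) :
    S₂Converges Ω χ q τ z₀ = fun f => TwoCauchyConverges (LinearIsometryEquiv.refl ℝ ℂ)
      (oscWeight χ τ z₀) (oscPotential Ω q τ z₀ f) := by
  funext f
  rw [S₂Converges, oscCutoff_eq]
  rfl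

end Operator

/-- The bounds between Lebesgue spaces for sources in `L^r`, in a form applying to `S₁` and `S₂`. -/
theorem exists_mapsBoundedly_rpow_neg_half {χ : ℂ → ℂ} (hχ : ContDiff ℝ 1 χ)
    (hχc : HasCompactSupport χ) {p r o : ℝ} {t : ℝ≥0∞} (hr₁ : 1 < r) (hr₂ : r < 2)
    (hro : 1 / r = 1 / 2 + 1 / o) (ho : 0 < o)
    [ENNReal.HolderTriple (ENNReal.ofReal p) t (ENNReal.ofReal r)] :
    ∃ C : ℝ, 0 ≤ C ∧ ∀ C', C ≤ C' → ∀ (Ω X : Set ℂ), UsualAssumptions Ω X χ → ∀ (τ : ℝ) (z₀ : ℂ),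
      0 < τ → ∀ q : ℂ → ℂ, MemLp q (ENNReal.ofReal p) (volume.restrict Ω) →
      ∀ l₁ l₂ : ℂ ≃ₗᵢ[ℝ] ℂ, MapsBoundedly X t (ENNReal.ofReal o)
        (fun f => TwoCauchyConverges l₂ (oscWeight χ τ z₀) (oscPotential Ω q τ z₀ f))
        (fun f => twoCauchy l₁ l₂ (oscWeight χ τ z₀) (oscPotential Ω q τ z₀ f))
        (C' * potentialNorm p Ω q * τ ^ (-(1 / 2) : ℝ)) := by
  obtain ⟨C, hC, hb⟩ := exists_eLpNorm_twoCauchy_le hχ hχc hr₁ hr₂ hro ho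
  refine ⟨C, hC, fun C' hC' Ω X h τ z₀ hτ q hq l₁ l₂ => ?_⟩
  have hP : 0 ≤ potentialNorm p Ω q := ENNReal.toReal_nonneg
  refine mapsBoundedly_twoCauchy (C := C * τ ^ (-(1 / 2) : ℝ)) h hr₁ hr₂ hq l₁ l₂ τ z₀
    (by positivity) (fun g hg => ?_) ?_
  · have := hb l₁ l₂ τ z₀ g hτ hg.meas hg.eq_zero hg.lt_top
    rwa [lintegral_rpow_rpow_eq_eLpNorm ho, lintegral_rpow_rpow_eq_eLpNorm (by linarith)] at this
  · rw [mul_right_comm]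
    gcongr

/-- The uniform bounds for sources in `L^r`, in a form applying to `S₁` and `S₂`. -/
theorem exists_mapsBoundedly_top {χ : ℂ → ℂ} (hχ : ContDiff ℝ 1 χ)
    (hχc : HasCompactSupport χ) {p r : ℝ} {t : ℝ≥0∞} (hr₁ : 1 < r) (hr₂ : r < 2)
    [ENNReal.HolderTriple (ENNReal.ofReal p) t (ENNReal.ofReal r)] :
    ∃ C : ℝ, 0 ≤ C ∧ ∀ C', C ≤ C' → ∀ (Ω X : Set ℂ), UsualAssumptions Ω X χ → ∀ (τ : ℝ) (z₀ : ℂ),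
      0 < τ → ∀ q : ℂ → ℂ, MemLp q (ENNReal.ofReal p) (volume.restrict Ω) →
      ∀ l₁ l₂ : ℂ ≃ₗᵢ[ℝ] ℂ, MapsBoundedly X t ∞
        (fun f => TwoCauchyConverges l₂ (oscWeight χ τ z₀) (oscPotential Ω q τ z₀ f))
        (fun f => twoCauchy l₁ l₂ (oscWeight χ τ z₀) (oscPotential Ω q τ z₀ f))
        (C' * potentialNorm p Ω q * τ ^ (-((1 - 1 / r) / 4))) := by
  obtain ⟨C, hC, hb⟩ := exists_enorm_twoCauchy_le hχ hχc hr₁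
  refine ⟨C, hC, fun C' hC' Ω X h τ z₀ hτ q hq l₁ l₂ => ?_⟩
  have hP : 0 ≤ potentialNorm p Ω q := ENNReal.toReal_nonneg
  refine mapsBoundedly_twoCauchy (C := C * τ ^ (-((1 - 1 / r) / 4))) h hr₁ hr₂ hq l₁ l₂ τ z₀
    (by positivity) (fun g hg => ?_) ?_
  · have := hb l₁ l₂ τ z₀ g hτ hg.meas hg.eq_zero hg.lt_top
    rw [lintegral_rpow_rpow_eq_eLpNorm (by linarith)] at this
    rw [eLpNorm_exponent_top]
    exact eLpNormEssSup_le_of_ae_enorm_bound (Filter.Eventually.of_forall this)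
  · rw [mul_right_comm]
    gcongr

theorem proposition4p4 (p pStar : ℝ) (hp₁ : 1 < p) (hp₂ : p < 2)
    (hpStar : 1 / p = 1 / 2 + 1 / pStar) :
    ∃ α : ℝ, 0 < α ∧ α < 1 / p ∧
      ∀ χ : ℂ → ℂ, ∃ C : ℝ, 0 < C ∧
        ∀ (Ω X : Set ℂ), UsualAssumptions Ω X χ →
        ∀ (τ : ℝ) (z₀ : ℂ), 1 < τ →
        ∀ q₁ q₂ : ℂ → ℂ,
          MemLp q₁ (ENNReal.ofReal p) (volume.restrict Ω) →
          MemLp q₂ (ENNReal.ofReal p) (volume.restrict Ω) →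
          (MapsBoundedly X ∞ (ENNReal.ofReal pStar)
              (S₁Converges Ω χ q₁ τ z₀) (opS₁ Ω χ q₁ τ z₀)
              (C * potentialNorm p Ω q₁ * τ ^ (-(1 / 2) : ℝ)) ∧
            MapsBoundedly X ∞ (ENNReal.ofReal pStar)
              (S₂Converges Ω χ q₂ τ z₀) (opS₂ Ω χ q₂ τ z₀)
              (C * potentialNorm p Ω q₂ * τ ^ (-(1 / 2) : ℝ))) ∧
          (MapsBoundedly X ∞ ∞
              (S₁Converges Ω χ q₁ τ z₀) (opS₁ Ω χ q₁ τ z₀)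
              (C * potentialNorm p Ω q₁ * τ ^ (-α)) ∧
            MapsBoundedly X ∞ ∞
              (S₂Converges Ω χ q₂ τ z₀) (opS₂ Ω χ q₂ τ z₀)
              (C * potentialNorm p Ω q₂ * τ ^ (-α))) ∧
          (4 / 3 < p →
            MapsBoundedly X (ENNReal.ofReal pStar) (ENNReal.ofReal (pStar / 2))
              (S₁Converges Ω χ q₁ τ z₀) (opS₁ Ω χ q₁ τ z₀)
              (C * potentialNorm p Ω q₁ * τ ^ (-(1 / 2) : ℝ)) ∧
            MapsBoundedly X (ENNReal.ofReal pStar) (ENNReal.ofReal (pStar / 2))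
              (S₂Converges Ω χ q₂ τ z₀) (opS₂ Ω χ q₂ τ z₀)
              (C * potentialNorm p Ω q₂ * τ ^ (-(1 / 2) : ℝ))) := by

  have hp0 : 0 < p := by linarith
  have h1p : 1 / 2 < 1 / p := one_div_lt_one_div_of_lt hp0 hp₂
  have h1p' : 1 / p < 1 := by rw [div_lt_one hp0]; exact hp₁
  have hS0 : 0 < pStar := one_div_pos.1 (by linarith)
  -- the exponent coming from interpolation with `ε = (1 - 1/p) / 2`
  refine ⟨(1 - 1 / p) / 4, by linarith, by linarith, fun χ => ?_⟩
  by_cases hχ : ContDiff ℝ ∞ χ ∧ HasCompactSupport χ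
  swap
  -- no domains satisfy the assumptions for such a `χ`
  · exact ⟨1, one_pos, fun Ω X h => absurd ⟨h.smooth, h.compactSupport⟩ hχ⟩
  have hχ1 : ContDiff ℝ 1 χ := hχ.1.of_le (by exact_mod_cast le_top)
  obtain ⟨C₁, hC₁, H₁⟩ := exists_mapsBoundedly_rpow_neg_half hχ1 hχ.2 (p := p) (t := ∞) hp₁ hp₂
    hpStar hS0
  obtain ⟨C₂, hC₂, H₂⟩ := exists_mapsBoundedly_top hχ1 hχ.2 (p := p) (r := p) (t := ∞) hp₁ hp₂
  have H₃ : ∃ C : ℝ, 0 ≤ C ∧ (4 / 3 < p → ∀ C', C ≤ C' → ∀ (Ω X : Set ℂ),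
      UsualAssumptions Ω X χ → ∀ (τ : ℝ) (z₀ : ℂ),
      0 < τ → ∀ q : ℂ → ℂ, MemLp q (ENNReal.ofReal p) (volume.restrict Ω) →
      ∀ l₁ l₂ : ℂ ≃ₗᵢ[ℝ] ℂ, MapsBoundedly X (ENNReal.ofReal pStar) (ENNReal.ofReal (pStar / 2))
        (fun f => TwoCauchyConverges l₂ (oscWeight χ τ z₀) (oscPotential Ω q τ z₀ f))
        (fun f => twoCauchy l₁ l₂ (oscWeight χ τ z₀) (oscPotential Ω q τ z₀ f))
        (C' * potentialNorm p Ω q * τ ^ (-(1 / 2) : ℝ))) := by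
    by_cases hp : 4 / 3 < p
    swap
    · exact ⟨0, le_rfl, fun h => absurd h hp⟩
    -- the source `q f` lies in `L^r` by Hölder's inequality, and `p > 4/3` means `r > 1`
    have h43 : 1 / p < 3 / 4 := by
      rw [div_lt_div_iff₀ hp0 (by norm_num)]; linarith
    have hinv : 0 < 1 / p + 1 / pStar := by positivity
    set r : ℝ := 1 / (1 / p + 1 / pStar) with hr
    have hrinv : 1 / r = 1 / p + 1 / pStar := by rw [hr, one_div_one_div]
    have hr0 : 0 < r := by positivity
    have hr₁ : 1 < r := by
      rw [hr, one_lt_div hinv]; linarith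
    have hr₂ : r < 2 := by
      rw [hr, div_lt_iff₀ hinv]
      have := one_div_pos.2 hS0
      linarith
    have : ENNReal.HolderTriple (ENNReal.ofReal p) (ENNReal.ofReal pStar) (ENNReal.ofReal r) := by
      constructor
      rw [← ENNReal.ofReal_inv_of_pos hp0, ← ENNReal.ofReal_inv_of_pos hS0,
        ← ENNReal.ofReal_inv_of_pos hr0, ← ENNReal.ofReal_add (by positivity) (by positivity)]
      congr 1
      simpa using hrinv.symm
    obtain ⟨C, hC, H⟩ := exists_mapsBoundedly_rpow_neg_half hχ1 hχ.2 (p := p)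
      (t := ENNReal.ofReal pStar) (o := pStar / 2) hr₁ hr₂
      (by rw [hrinv, hpStar, one_div_div]; ring) (by positivity)
    exact ⟨C, hC, fun _ => H⟩
  obtain ⟨C₃, hC₃, H₃⟩ := H₃
  refine ⟨C₁ + C₂ + C₃ + 1, by positivity, fun Ω X h τ z₀ hτ q₁ q₂ hq₁ hq₂ => ?_⟩
  have hτ0 : 0 < τ := by linarith
  simp only [opS₁_eq_twoCauchy, opS₂_eq_twoCauchy, S₁Converges_eq, S₂Converges_eq]
  have K₁ := H₁ (C₁ + C₂ + C₃ + 1) (by linarith) Ω X h τ z₀ hτ0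
  have K₂ := H₂ (C₁ + C₂ + C₃ + 1) (by linarith) Ω X h τ z₀ hτ0
  refine ⟨⟨K₁ q₁ hq₁ _ _, K₁ q₂ hq₂ _ _⟩, ⟨K₂ q₁ hq₁ _ _, K₂ q₂ hq₂ _ _⟩, fun hp => ?_⟩
  have K₃ := H₃ hp (C₁ + C₂ + C₃ + 1) (by linarith) Ω X h τ z₀ hτ0
  exact ⟨K₃ q₁ hq₁ _ _, K₃ q₂ hq₂ _ _⟩
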